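/- Let $M_\bullet$ be a simplicial (smooth) manifold with face maps $d_j$ and degeneracy maps $s_j$. Let $\Delta^n=\{(t_0,\dots,t_n)\mid t_i\ge 0,\ \sum_i t_i=1\}$, oriented by the coordinates $(t_1,\dots,t_n)$, with the maps $\tau_j:\Delta^{n-1}\to\Delta^{n}$, $(t_0,\dots,t_{n-1})\mapsto(t_0,\dots,t_{j-1},0,t_j,\dots,t_{n-1})$, and $\eta_j:\Delta^{n}\to\Delta^{n-1}$, $(t_0,\dots,t_n)\mapsto(t_0,\dots,t_j+t_{j+1},\dots,t_n)$. A differential $p$-form on $|M_\bullet|$ is a family $\phi=\{\phi_n\}_{n\ge 0}$ of smooth real $p$-forms $\phi_n$ on $\Delta^n\times M_n$ such that, for all $n\ge1$ and all $j$ for which the maps are defined, $(\tau_j\times\mathrm{id})^*\phi_n=(\mathrm{id}\times d_j)^*\phi_{n-1}$ on $\Delta^{n-1}\times M_n$ and $(\eta_j\times\mathrm{id})^*\phi_{n-1}=(\mathrm{id}\times s_j)^*\phi_n$ on $\Delta^n\times M_{n-1}$. The space of these is $\Omega^p(|M_\bullet|)$, with $d\{\phi_n\}=\{d\phi_n\}$.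 The normalized total complex is $\mathrm{Tot}^p(M_\bullet)=\bigoplus_{k+l=p}C^{k,l}$, where $C^{k,l}\subseteq\Omega^l(M_k)$ consists of the forms $\alpha$ with $s_i^*\alpha=0$ for $0\le i\le k-1$ (no condition if $k=0$), with differential $D=\delta+(-1)^k d$ on $C^{k,l}$, where $\delta=\sum_{j=0}^{k+1}(-1)^j d_j^*$. For a $p$-form $\phi_n$ on $\Delta^n\times M_n$ with $p\ge n$, let $\int_{\Delta^n}\phi_n$ be the $(p-n)$-form on $M_n$ given by $$\Big(\int_{\Delta^n}\phi_n\Big)_x(w_1,\dots,w_{p-n})=\int_{\Delta^n}(\phi_n)_{(t,x)}\Big(\tfrac{\partial}{\partial t_1},\dots,\tfrac{\partial}{\partial t_n},w_1,\dots,w_{p-n}\Big)\,dt_1\cdots dt_n .$$ Then, for every $p$, $\phi\mapsto\{\int_{\Delta^n}\phi_n\}_{0\le n\le p}$ is a linear map $\Omega^p(|M_\bullet|)\to\mathrm{Tot}^p(M_\bullet)$; moreover, for every $\phi\in\Omega^p(|M_\bullet|)$ one has $d\phi\in\Omega^{p+1}(|M_\bullet|)$ and $$D\Big(\Big\{\int_{\Delta^n}\phi_n\Big\}\Big)=\Big\{\int_{\Delta^n}d\phi_n\Big\}\in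 \mathrm{Tot}^{p+1}(M_\bullet),$$ that is, integration along the simplices is a cochain map. -/

import Mathlib

open CategoryTheory Set MeasureTheory
open scoped Manifold ContDiff

universe u

noncomputable section

/-! ### The category of smooth manifolds -/

/-- A smooth manifold (finite-dimensional, without boundary, Hausdorff, second countable). -/
structure SmoothMfd : Type (u + 1) where
  carrier : Type u
  dim : ℕ
  [topology : TopologicalSpace carrier]
  [charted : ChartedSpace (EuclideanSpace ℝ (Fin dim)) carrier]
  [isManifold : IsManifold (𝓡 dim) ∞ carrier]
  [t2 : T2Space carrier]
  [secondCountable : SecondCountableTopology carrier]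

namespace SmoothMfd

instance : CoeSort SmoothMfd.{u} (Type u) := ⟨SmoothMfd.carrier⟩

attribute [instance] SmoothMfd.topology SmoothMfd.charted SmoothMfd.isManifold SmoothMfd.t2
  SmoothMfd.secondCountable

/-- A smooth map between smooth manifolds. -/
@[ext]
structure Hom (M N : SmoothMfd.{u}) : Type u where
  toFun : M → N
  smooth : ContMDiff (𝓡 M.dim) (𝓡 N.dim) ∞ toFun

instance : Category SmoothMfd.{u} where
  Hom := Hom
  id M := ⟨fun x => x, contMDiff_id⟩
  comp f g := ⟨fun x => g.toFun (f.toFun x), g.smooth.comp f.smooth⟩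

end SmoothMfd

/-! ### Differential forms on (subsets of) manifolds -/

section Forms

variable {E : Type*} [NormedAddCommGroup E] [NormedSpace ℝ E]
  {H : Type*} [TopologicalSpace H] (I : ModelWithCorners ℝ E H)
  {E' : Type*} [NormedAddCommGroup E'] [NormedSpace ℝ E']
  {H' : Type*} [TopologicalSpace H'] (I' : ModelWithCorners ℝ E' H')

/-- A not necessarily smooth real `k`-form on `X`: an alternating `k`-linear form on each tangent
space. -/
abbrev RawForm (X : Type*) [TopologicalSpace X] [ChartedSpace H X] (k : ℕ) : Type _ :=
  (x : X) → (TangentSpace I x) [⋀^Fin k]→L[ℝ] ℝ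

variable {X : Type*} [TopologicalSpace X] [ChartedSpace H X]
  {Y : Type*} [TopologicalSpace Y] [ChartedSpace H' Y] {k : ℕ}

variable {I'} in
/-- The pullback `f^* θ`, that is `(f^* θ)_x (v₁, …, v_k) = θ_{f x} (df v₁, …, df v_k)`. -/
def RawForm.pullback (f : X → Y) (θ : RawForm I' Y k) : RawForm I X k := fun x =>
  (θ (f x)).compContinuousLinearMap (mfderiv I I' f x)

variable {I}

/-- The expression of a form in the preferred chart at `x₀`: its pullback, under the inverse of the
chart, to the model vector space. -/
def RawForm.inChart (θ : RawForm I X k) (x₀ : X) : E → E [⋀^Fin k]→L[ℝ] ℝ := fun y =>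
  (θ ((extChartAt I x₀).symm y)).compContinuousLinearMap
    (mfderivWithin 𝓘(ℝ, E) I (extChartAt I x₀).symm (range I) y)

/-- The part of the target of the preferred chart at `x₀` that corresponds to points of `S`. -/
def chartDomain (I : ModelWithCorners ℝ E H) (S : Set X) (x₀ : X) : Set E :=
  (extChartAt I x₀).target ∩ (extChartAt I x₀).symm ⁻¹' S

/-- A form is smooth on `S` if its coefficients in each chart are smooth (up to the boundary of `S`,
when `S` is a domain with corners). -/
def RawForm.SmoothOn (S : Set X) (θ : RawForm I X k) : Prop :=
  ∀ x₀ : X, ContDiffOn ℝ ∞ (θ.inChart x₀) (chartDomain I S x₀)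

/-- The exterior derivative, on `S`, of a form, computed at each point in the preferred chart
there. Derivatives are taken within `S`, so that `S` may be a domain with corners. -/
def RawForm.d (S : Set X) (θ : RawForm I X k) : RawForm I X (k + 1) := fun x =>
  (extDerivWithin (θ.inChart x) (chartDomain I S x) (extChartAt I x x)).compContinuousLinearMap
    (mfderiv I 𝓘(ℝ, E) (extChartAt I x) x)

variable (I) in
/-- The space `Ω^k(S)` of smooth `k`-forms on `S`, where `S` is all of the manifold `X` or a domain
with corners in it. A form on `S` is represented by its extension by zero to `X`. -/
def smoothForms (S : Set X) (k : ℕ) : Submodule ℝ (RawForm I X k) where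
  carrier := {θ | θ.SmoothOn S ∧ ∀ x ∉ S, θ x = 0}
  zero_mem' := ⟨fun _ => contDiffOn_const (c := 0), fun _ _ => rfl⟩
  add_mem' := fun {a b} ha hb =>
    ⟨fun x₀ => (ha.1 x₀).add (hb.1 x₀), fun x hx => by
      rw [Pi.add_apply, ha.2 x hx, hb.2 x hx, add_zero]⟩
  smul_mem' := fun c a ha =>
    ⟨fun x₀ => (ha.1 x₀).const_smul c, fun x hx => by
      rw [Pi.smul_apply, ha.2 x hx, smul_zero]⟩

end Forms

/-! ### The standard simplices -/

/-- The barycentric coordinates `(t₀, t₁, …, t_n)`, with `t₀ = 1 - t₁ - … - t_n`, of the point with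
coordinates `(t₁, …, t_n)`. -/
def bary {n : ℕ} (t : Fin n → ℝ) : Fin (n + 1) → ℝ := Fin.cons (1 - ∑ i, t i) t

/-- The standard `n`-simplex `{(t₀, …, t_n) | t_i ≥ 0, ∑ t_i = 1}`, as a domain with corners in
`ℝⁿ` through its coordinates `(t₁, …, t_n)`. -/
def simplex (n : ℕ) : Set (Fin n → ℝ) := {t | bary t ∈ stdSimplex ℝ (Fin (n + 1))}

/-- The coface map `(t₀, …, t_n) ↦ (t₀, …, t_{j-1}, 0, t_j, …, t_n)`. -/
def simplexFace {n : ℕ} (j : Fin (n + 2)) (t : Fin n → ℝ) : Fin (n + 1) → ℝ :=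
  Fin.tail (j.insertNth (α := fun _ => ℝ) 0 (bary t) : Fin (n + 2) → ℝ)

/-- The codegeneracy map `(t₀, …, t_{n+1}) ↦ (t₀, …, t_j + t_{j+1}, …, t_{n+1})`. -/
def simplexDegen {n : ℕ} (j : Fin (n + 1)) (t : Fin (n + 1) → ℝ) : Fin n → ℝ :=
  Fin.tail (fun i : Fin (n + 1) => ∑ l : Fin (n + 2) with j.predAbove l = i, bary t l)

/-! ### Differential forms on the geometric realization of a simplicial manifold -/

variable (M : SimplicialObject SmoothMfd.{u})

/-- The manifold `M_n` of a simplicial manifold `M_•`. -/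
abbrev level (n : ℕ) : SmoothMfd.{u} := M.obj (Opposite.op (SimplexCategory.mk n))

/-- The model of the manifold (with corners) `Δⁿ × M_m ⊆ ℝⁿ × M_m`. -/
abbrev prodModel (n m : ℕ) := 𝓘(ℝ, Fin n → ℝ).prod (𝓡 (level M m).dim)

/-- The subset `Δⁿ × M_m` of `ℝⁿ × M_m`. -/
abbrev simplexProd (n m : ℕ) : Set ((Fin n → ℝ) × (level M m)) := simplex n ×ˢ univ

/-- Families of not necessarily smooth or compatible `p`-forms on the `ℝⁿ × M_n`. -/
abbrev RawFamily (p : ℕ) : Type u :=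
  (n : ℕ) → RawForm (prodModel M n n) ((Fin n → ℝ) × (level M n)) p

variable {M} in
/-- The gluing conditions `(τ_j × id)^* φ_{n+1} = (id × d_j)^* φ_n` on `Δⁿ × M_{n+1}` and
`(η_j × id)^* φ_n = (id × s_j)^* φ_{n+1}` on `Δ^{n+1} × M_n`. -/
def RawFamily.Compatible {p : ℕ} (φ : RawFamily M p) : Prop :=
  (∀ (n : ℕ) (j : Fin (n + 2)), ∀ q ∈ simplexProd M n (n + 1),
    RawForm.pullback (prodModel M n (n + 1)) (Prod.map (simplexFace j) id) (φ (n + 1)) q =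
      RawForm.pullback (prodModel M n (n + 1)) (Prod.map id (M.δ j).toFun) (φ n) q) ∧
  (∀ (n : ℕ) (j : Fin (n + 1)), ∀ q ∈ simplexProd M (n + 1) n,
    RawForm.pullback (prodModel M (n + 1) n) (Prod.map (simplexDegen j) id) (φ n) q =
      RawForm.pullback (prodModel M (n + 1) n) (Prod.map id (M.σ j).toFun) (φ (n + 1)) q)

/-- The space `Ω^p(|M_•|)` of differential `p`-forms on the geometric realization: compatible
families of smooth `p`-forms `φ_n` on `Δⁿ × M_n`. -/
def realizationForms (p : ℕ) : Submodule ℝ (RawFamily M p) where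
  carrier := {φ | (∀ n, φ n ∈ smoothForms (prodModel M n n) (simplexProd M n n) p) ∧
    φ.Compatible}
  zero_mem' := ⟨fun _ => Submodule.zero_mem _, fun _ _ _ _ => rfl, fun _ _ _ _ => rfl⟩
  add_mem' := fun ha hb => ⟨fun n => Submodule.add_mem _ (ha.1 n) (hb.1 n),
    fun n j q hq => congrArg₂ (· + ·) (ha.2.1 n j q hq) (hb.2.1 n j q hq),
    fun n j q hq => congrArg₂ (· + ·) (ha.2.2 n j q hq) (hb.2.2 n j q hq)⟩
  smul_mem' := fun c _ ha => ⟨fun n => Submodule.smul_mem _ c (ha.1 n),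
    fun n j q hq => congrArg (c • ·) (ha.2.1 n j q hq),
    fun n j q hq => congrArg (c • ·) (ha.2.2 n j q hq)⟩

variable {M} in
/-- The exterior derivative `d{φ_n} = {dφ_n}`, with `dφ_n` taken on `Δⁿ × M_n`. -/
def RawFamily.d {p : ℕ} (φ : RawFamily M p) : RawFamily M (p + 1) := fun n =>
  RawForm.d (simplexProd M n n) (φ n)

/-! ### The normalized total complex -/

/-- The bidegrees `(k, l)` with `k + l = p`. -/
abbrev Bidegree (p : ℕ) : Type := {kl : ℕ × ℕ // kl.1 + kl.2 = p}

/-- Families of not necessarily smooth or normalized forms: an `l`-form on `M_k` for each bidegree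
`(k, l)` with `k + l = p`. -/
abbrev RawTot (p : ℕ) : Type u :=
  (b : Bidegree p) → RawForm (𝓡 (level M b.1.1).dim) (level M b.1.1) b.1.2

/-- The bidegree `(k, l)` part `C^{k,l}` of the normalized double complex: smooth `l`-forms on
`M_k` that are killed by all `s_i^*`. -/
def normalizedForms : (k l : ℕ) → Submodule ℝ (RawForm (𝓡 (level M k).dim) (level M k) l)
  | 0, l => smoothForms (𝓡 (level M 0).dim) univ l
  | k + 1, l =>
    { carrier := {α | α ∈ smoothForms (𝓡 (level M (k + 1)).dim) univ l ∧
        ∀ i : Fin (k + 1), RawForm.pullback (𝓡 (level M k).dim) (M.σ i).toFun α = 0}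
      zero_mem' := ⟨Submodule.zero_mem _, fun _ => rfl⟩
      add_mem' := fun ha hb => ⟨Submodule.add_mem _ ha.1 hb.1, fun i =>
        (congrArg₂ (· + ·) (ha.2 i) (hb.2 i)).trans (add_zero 0)⟩
      smul_mem' := fun c _ ha => ⟨Submodule.smul_mem _ c ha.1, fun i =>
        (congrArg (c • ·) (ha.2 i)).trans (smul_zero c)⟩ }

/-- The degree `p` part `⨁_{k + l = p} C^{k,l}` of the normalized total complex. -/
def Tot (p : ℕ) : Submodule ℝ (RawTot M p) where
  carrier := {α | ∀ b, α b ∈ normalizedForms M b.1.1 b.1.2}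
  zero_mem' := fun _ => Submodule.zero_mem _
  add_mem' := fun ha hb b => Submodule.add_mem _ (ha b) (hb b)
  smul_mem' := fun c _ ha b => Submodule.smul_mem _ c (ha b)

variable {M}

/-- The horizontal differential `δ = ∑_j (-1)^j d_j^*`, from forms on `M_k` to forms on
`M_{k+1}`. -/
def horDiff {k l : ℕ} (α : RawForm (𝓡 (level M k).dim) (level M k) l) :
    RawForm (𝓡 (level M (k + 1)).dim) (level M (k + 1)) l :=
  ∑ j : Fin (k + 2), (-1 : ℝ) ^ (j : ℕ) • RawForm.pullback (𝓡 (level M (k + 1)).dim) (M.δ j).toFun α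

/-- The contribution `δ α_{k-1}` (zero if `k = 0`) to the component of `D α` on `M_k`. -/
def RawTot.horPart {p : ℕ} (α : RawTot M p) : RawTot M (p + 1)
  | ⟨(0, _), _⟩ => 0
  | ⟨(k + 1, l), h⟩ => horDiff (α ⟨(k, l), by dsimp only at h ⊢; omega⟩)

/-- The contribution `(-1)^k d α_k` (zero in form degree `0`) to the component of `D α` on `M_k`. -/
def RawTot.vertPart {p : ℕ} (α : RawTot M p) : RawTot M (p + 1)
  | ⟨(_, 0), _⟩ => 0
  | ⟨(k, l + 1), h⟩ =>
    (-1 : ℝ) ^ k • RawForm.d univ (α ⟨(k, l), by dsimp only at h ⊢; omega⟩)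

/-- The total differential `D = δ + (-1)^{horizontal degree} d`. -/
def RawTot.D {p : ℕ} (α : RawTot M p) : RawTot M (p + 1) := α.horPart + α.vertPart

/-! ### Integration along the simplices -/

/-- The vectors `(e₁, 0), …, (e_n, 0), (0, w₁), …, (0, w_l)` in `ℝⁿ × W`. -/
def verticalThen {W : Type*} [AddCommGroup W] {n l p : ℕ} (h : n + l = p) (w : Fin l → W) :
    Fin p → (Fin n → ℝ) × W := fun i =>
  Fin.append (fun a : Fin n => ((Pi.single a 1, 0) : (Fin n → ℝ) × W))
    (fun b : Fin l => (0, w b)) (Fin.cast h.symm i)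

theorem verticalThen_natAdd {W : Type*} [AddCommGroup W] {n l p : ℕ} (h : n + l = p)
    (w : Fin l → W) (b : Fin l) : verticalThen h w (Fin.cast h (Fin.natAdd n b)) = (0, w b) := by
  simp [verticalThen]

theorem verticalThen_update {W : Type*} [AddCommGroup W] {n l p : ℕ} (h : n + l = p)
    [DecidableEq (Fin l)] (w : Fin l → W) (b : Fin l) (x : W) :
    verticalThen h (Function.update w b x) =
      Function.update (verticalThen h w) (Fin.cast h (Fin.natAdd n b)) (0, x) := by
  subst h
  funext i
  refine Fin.addCases (fun a => ?_) (fun c => ?_) i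
  · rw [Function.update_of_ne]
    · simp [verticalThen]
    · intro e
      have := congrArg Fin.val e
      simp at this
      omega
  · by_cases hc : c = b
    · subst hc
      simp [verticalThen]
    · rw [Function.update_of_ne]
      · simp [verticalThen, Function.update_of_ne hc]
      · intro e
        apply hc
        have := congrArg Fin.val e
        simp at this
        omega

/-- Plugging in the standard basis `e₁, …, e_n` of `ℝⁿ` into the first `n` arguments of an
alternating form on `ℝⁿ × W`:
`(w₁, …, w_l) ↦ θ ((e₁, 0), …, (e_n, 0), (0, w₁), …, (0, w_l))`. -/
def contractVertical {W : Type*} [NormedAddCommGroup W] [NormedSpace ℝ W] {n l p : ℕ}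
    (h : n + l = p) (θ : ((Fin n → ℝ) × W) [⋀^Fin p]→L[ℝ] ℝ) : W [⋀^Fin l]→L[ℝ] ℝ where
  toFun w := θ (verticalThen h w)
  map_update_add' w b x y := by
    have e : ((0, x + y) : (Fin n → ℝ) × W) = (0, x) + (0, y) := by simp
    simp only [verticalThen_update, e, θ.map_update_add]
  map_update_smul' w b c x := by
    have e : ((0, c • x) : (Fin n → ℝ) × W) = c • (0, x) := by simp
    simp only [verticalThen_update, e, θ.map_update_smul]
  map_eq_zero_of_eq' w b c hw hbc := by
    refine θ.map_eq_zero_of_eq (verticalThen h w) (i := Fin.cast h (Fin.natAdd n b))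
      (j := Fin.cast h (Fin.natAdd n c)) ?_ ?_
    · rw [verticalThen_natAdd, verticalThen_natAdd, hw]
    · intro e
      apply hbc
      have := congrArg Fin.val e
      simp at this
      omega
  cont := by
    refine θ.cont.comp ?_
    subst h
    refine continuous_pi fun i => ?_
    refine Fin.addCases (fun a => ?_) (fun c => ?_) i
    · simp only [verticalThen, Fin.cast_eq_self, Fin.append_left]
      exact continuous_const
    · simp only [verticalThen, Fin.cast_eq_self, Fin.append_right]
      exact continuous_const.prodMk (continuous_apply c)

/-- Integration along the fibre `Δⁿ` (oriented by the coordinates `(t₁, …, t_n)`) of a `p`-form on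
`Δⁿ × M_n`, for `p = n + l`: the `l`-form
`x ↦ ((w₁, …, w_l) ↦ ∫_{Δⁿ} φ_{(t,x)} (∂/∂t₁, …, ∂/∂t_n, w₁, …, w_l) dt₁ … dt_n)` on `M_n`. -/
def fiberIntegral {n l p : ℕ} (h : n + l = p)
    (φ : RawForm (prodModel M n n) ((Fin n → ℝ) × (level M n)) p) :
    RawForm (𝓡 (level M n).dim) (level M n) l := fun x =>
  (∫ t in simplex n, contractVertical (W := EuclideanSpace ℝ (Fin (level M n).dim)) h (φ (t, x)) :
    EuclideanSpace ℝ (Fin (level M n).dim) [⋀^Fin l]→L[ℝ] ℝ)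

/-- The family `{∫_{Δⁿ} φ_n}`. -/
def RawFamily.integral {p : ℕ} (φ : RawFamily M p) : RawTot M p := fun b =>
  fiberIntegral b.2 (φ b.1.1)

end

/-! Evaluate `dφ_n` at `(t, x)` on `e₁, …, e_n, w₁, …, w_l` in a product chart. The alternating-sum
formula for the exterior derivative (`alternatizeUncurryFin_blockVec`) has two kinds of terms.

The terms that differentiate along some `w_b` carry the sign `(-1)^(n+b)`. Differentiation under the
integral sign turns them into `(-1)^n d ∫ φ_n` (`extDerivWithin_integral_contractVertical`); this is
the origin of the sign in `D`.

The terms that differentiate along some `e_a` form, for fixed `x` and `w`, the exterior derivative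
of an `(n-1)`-form on `Δⁿ`. Stokes' theorem (`simplex_stokes`) gives the alternating sum of the
integrals of `(τ_j × id)^* φ_n` over `Δ^{n-1}`. The gluing condition replaces these by `(id × d_j)^*
φ_{n-1}`, whose integrals are `d_j^* ∫ φ_{n-1}`, so the sum is `δ ∫ φ_{n-1}`
(`integral_vertical_eq_horDiff`).

Stokes' theorem itself is the fundamental theorem of calculus in each coordinate. The `i`-th
integration yields the face where that coordinate vanishes and the slanted face opposite the vertex
`0`, parametrized by the other coordinates. All these parametrizations of the slanted face give
equal integrals (`setIntegral_simplex_insertNth`), and an alternating form on the edges at a vertex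
of that face expands in exactly the terms obtained
(`AlternatingMap.map_single_succ_sub_single_zero`).

The integrals are normalized because `(id × s_i)^* φ_{k+1} = (η_i × id)^* φ_k` is pulled back from a
space with only `k` simplex directions, hence vanishes on `k + 1` of them. Finally `dφ` is again a
compatible family because `d` commutes with pullback, also on domains with corners
(`RawForm.d_pullback`). -/

open Filter Topology

noncomputable section

/-! ### Forms in charts -/
section FormsLemmas

variable {E : Type*} [NormedAddCommGroup E] [NormedSpace ℝ E]
  {H : Type*} [TopologicalSpace H] {I : ModelWithCorners ℝ E H}
  {E' : Type*} [NormedAddCommGroup E'] [NormedSpace ℝ E']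
  {H' : Type*} [TopologicalSpace H'] {I' : ModelWithCorners ℝ E' H'}
  {X : Type*} [TopologicalSpace X] [ChartedSpace H X]
  {Y : Type*} [TopologicalSpace Y] [ChartedSpace H' Y] {k : ℕ}

/-- A form as a function with values in the alternating forms on the model space. -/
def RawForm.val (θ : RawForm I X k) : X → E [⋀^Fin k]→L[ℝ] ℝ := θ

variable (I I') in
/-- The derivative of a map, as a linear map between the model spaces. -/
def modelDeriv (f : X → Y) (x : X) : E →L[ℝ] E' := mfderiv I I' f x

theorem RawForm.val_pullback (f : X → Y) (θ : RawForm I' Y k) (x : X) :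
    (RawForm.pullback I f θ).val x =
      (θ.val (f x)).compContinuousLinearMap (modelDeriv I I' f x) := rfl

theorem RawForm.val_d (S : Set X) (θ : RawForm I X k) (x : X) :
    (RawForm.d S θ).val x =
      (extDerivWithin (θ.inChart x) (chartDomain I S x) (extChartAt I x x)).compContinuousLinearMap
        (modelDeriv I 𝓘(ℝ, E) (extChartAt I x) x) := rfl

theorem RawForm.inChart_eq [I.Boundaryless] (θ : RawForm I X k) (x₀ : X) (y : E) :
    θ.inChart x₀ y = (θ.val ((extChartAt I x₀).symm y)).compContinuousLinearMap
      (modelDeriv 𝓘(ℝ, E) I (extChartAt I x₀).symm y) := by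
  unfold modelDeriv
  rw [← mfderivWithin_univ, ← I.range_eq_univ]
  rfl

variable {E'' : Type*} [NormedAddCommGroup E''] [NormedSpace ℝ E'']
  {H'' : Type*} [TopologicalSpace H''] {I'' : ModelWithCorners ℝ E'' H''}
  {Z : Type*} [TopologicalSpace Z] [ChartedSpace H'' Z]

theorem modelDeriv_comp {g : Y → Z} {f : X → Y} {x : X} (hg : MDifferentiableAt I' I'' g (f x))
    (hf : MDifferentiableAt I I' f x) :
    modelDeriv I I'' (g ∘ f) x = (modelDeriv I' I'' g (f x)).comp (modelDeriv I I' f x) :=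
  mfderiv_comp x hg hf

theorem modelDeriv_congr {f g : X → Y} {x : X} (h : f =ᶠ[𝓝 x] g) :
    modelDeriv I I' f x = modelDeriv I I' g x := h.mfderiv_eq

theorem modelDeriv_eq_fderiv (f : E → E') (x : E) :
    modelDeriv 𝓘(ℝ, E) 𝓘(ℝ, E') f x = fderiv ℝ f x := mfderiv_eq_fderiv

section
variable [IsManifold I ∞ X] [I.Boundaryless] [I'.Boundaryless] [IsManifold I' ∞ Y]

theorem mdifferentiableAt_extChartAt_symm {x₀ : X} {z : E} (hz : z ∈ (extChartAt I x₀).target) :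
    MDifferentiableAt 𝓘(ℝ, E) I (extChartAt I x₀).symm z := by
  have : IsManifold I 1 X := IsManifold.of_le (n := ∞) (by norm_num)
  have := mdifferentiableWithinAt_extChartAt_symm hz
  rwa [I.range_eq_univ, mdifferentiableWithinAt_univ] at this

omit [I.Boundaryless] in
theorem mdifferentiableAt_extChartAt_of_mem {x₀ x : X} (hx : x ∈ (extChartAt I x₀).source) :
    MDifferentiableAt I 𝓘(ℝ, E) (extChartAt I x₀) x := by
  have : IsManifold I 1 X := IsManifold.of_le (n := ∞) (by norm_num)
  exact mdifferentiableAt_extChartAt (by rwa [extChartAt_source] at hx)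

/-- Chain rule: near the point, the chart at `y₀` followed by its inverse is the identity, so
inserting both around `F` changes no derivative. This reduces naturality of `d` to a statement about
maps between vector spaces. -/
theorem RawForm.inChart_pullback {F : X → Y} (θ : RawForm I' Y k) {x₀ : X} {y₀ : Y} {z : E}
    (hz : z ∈ (extChartAt I x₀).target) (hF : MDifferentiableAt I I' F ((extChartAt I x₀).symm z))
    (hFz : F ((extChartAt I x₀).symm z) ∈ (extChartAt I' y₀).source) :
    (RawForm.pullback I F θ).inChart x₀ z =
      (θ.inChart y₀ (extChartAt I' y₀ (F ((extChartAt I x₀).symm z)))).compContinuousLinearMap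
        (fderiv ℝ (extChartAt I' y₀ ∘ F ∘ (extChartAt I x₀).symm) z) := by
  have h1 := mdifferentiableAt_extChartAt_symm hz
  have h2 := mdifferentiableAt_extChartAt_of_mem hFz
  have h3 := mdifferentiableAt_extChartAt_symm ((extChartAt I' y₀).map_source hFz)
  have hFs : MDifferentiableAt 𝓘(ℝ, E) I' (F ∘ (extChartAt I x₀).symm) z := hF.comp z h1
  have key : (modelDeriv 𝓘(ℝ, E') I' (extChartAt I' y₀).symm
        (extChartAt I' y₀ (F ((extChartAt I x₀).symm z)))).comp
        (fderiv ℝ (extChartAt I' y₀ ∘ F ∘ (extChartAt I x₀).symm) z) =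
      (modelDeriv I I' F ((extChartAt I x₀).symm z)).comp
        (modelDeriv 𝓘(ℝ, E) I (extChartAt I x₀).symm z) := by
    rw [← modelDeriv_eq_fderiv, ← modelDeriv_comp hF h1]
    have h4 : MDifferentiableAt 𝓘(ℝ, E) 𝓘(ℝ, E')
        (extChartAt I' y₀ ∘ F ∘ (extChartAt I x₀).symm) z :=
      MDifferentiableAt.comp (g := extChartAt I' y₀) z h2 hFs
    refine (modelDeriv_comp (g := (extChartAt I' y₀).symm)
      (f := extChartAt I' y₀ ∘ F ∘ (extChartAt I x₀).symm) h3 h4).symm.trans ?_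
    apply modelDeriv_congr
    have := hFs.continuousAt.preimage_mem_nhds (extChartAt_source_mem_nhds' hFz)
    filter_upwards [this] with w hw
    exact (extChartAt I' y₀).left_inv hw
  rw [RawForm.inChart_eq, RawForm.inChart_eq, RawForm.val_pullback, (extChartAt I' y₀).left_inv hFz]
  ext v
  exact congrArg (θ.val (F ((extChartAt I x₀).symm z)))
    (funext fun i => (congrArg (fun L : E →L[ℝ] E' => L (v i)) key).symm)

theorem RawForm.inChart_model (θ : RawForm 𝓘(ℝ, E) E k) (x₀ y : E) :
    θ.inChart x₀ y = θ.val y := by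
  have : modelDeriv 𝓘(ℝ, E) 𝓘(ℝ, E) (extChartAt 𝓘(ℝ, E) x₀).symm y =
      ContinuousLinearMap.id ℝ E := by
    rw [modelDeriv_eq_fderiv]
    exact fderiv_id
  rw [RawForm.inChart_eq, this]
  rfl

theorem chartDomain_model (S : Set E) (x₀ : E) : chartDomain 𝓘(ℝ, E) S x₀ = S := by
  simp [chartDomain, chartAt_self_eq]

theorem RawForm.val_d_model (S : Set E) (θ : RawForm 𝓘(ℝ, E) E k) (x : E) :
    (RawForm.d S θ).val x = extDerivWithin θ.val S x := by
  have h1 : modelDeriv 𝓘(ℝ, E) 𝓘(ℝ, E) (extChartAt 𝓘(ℝ, E) x) x = ContinuousLinearMap.id ℝ E := by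
    rw [modelDeriv_eq_fderiv]
    exact fderiv_id
  have h2 : θ.inChart x = θ.val := funext fun y => θ.inChart_model x y
  rw [RawForm.val_d, chartDomain_model, h1, h2]
  rfl

/-- A set whose expressions in all charts have unique derivatives and are contained in the closure
of their interior. -/
def RegularDomain (I : ModelWithCorners ℝ E H) (S : Set X) : Prop :=
  ∀ x₀ : X, UniqueDiffOn ℝ (chartDomain I S x₀) ∧
    chartDomain I S x₀ ⊆ closure (interior (chartDomain I S x₀))

/-- The exterior derivative is natural: it commutes with pullbacks. -/
theorem RawForm.d_pullback {F : X → Y} {S : Set X} {T : Set Y} {θ : RawForm I' Y k}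
    {θ' : RawForm I X k} {x : X} (hS : UniqueDiffOn ℝ (chartDomain I S x))
    (hSc : chartDomain I S x ⊆ closure (interior (chartDomain I S x)))
    (hθ : θ.SmoothOn T) (hx : x ∈ S)
    (hF' : ∀ᶠ y in 𝓝 x, ContMDiffAt I I' ∞ F y)
    (hST : ∀ᶠ y in 𝓝[S] x, F y ∈ T)
    (heq : ∀ᶠ y in 𝓝[S] x, θ'.val y = (RawForm.pullback I F θ).val y) :
    (RawForm.d S θ').val x = (RawForm.pullback I F (RawForm.d T θ)).val x := by
  set z₀ : E := extChartAt I x x with hz₀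
  set s : Set E := chartDomain I S x
  set t : Set E' := chartDomain I' T (F x)
  set f : E → E' := extChartAt I' (F x) ∘ F ∘ (extChartAt I x).symm with hf
  have hzx : (extChartAt I x).symm z₀ = x := extChartAt_to_inv x
  have hcs : ContinuousAt (extChartAt I x).symm z₀ := continuousAt_extChartAt_symm x
  have htgt : (extChartAt I x).target ∈ 𝓝 z₀ := extChartAt_target_mem_nhds x
  have hF : ContMDiffAt I I' ∞ F x := hF'.self_of_nhds
  have hFsrc : ∀ᶠ y in 𝓝 x, F y ∈ (extChartAt I' (F x)).source :=
    hF.continuousAt.preimage_mem_nhds (extChartAt_source_mem_nhds (F x))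
  have hev : ∀ᶠ y in 𝓝 x, MDifferentiableAt I I' F y ∧ F y ∈ (extChartAt I' (F x)).source ∧
      (y ∈ S → F y ∈ T) ∧ (y ∈ S → θ'.val y = (RawForm.pullback I F θ).val y) := by
    filter_upwards [hF', hFsrc, eventually_nhdsWithin_iff.1 hST, eventually_nhdsWithin_iff.1 heq]
      with y h1 h2 h3 h4
    exact ⟨h1.mdifferentiableAt (by simp), h2, h3, h4⟩
  have hcs' : Tendsto (extChartAt I x).symm (𝓝 z₀) (𝓝 x) := by
    have := hcs.tendsto
    rwa [hzx] at this
  -- All hypotheses hold only near `x`. The argument is therefore carried out on `s ∩ V` with `V`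
  -- open, which does not affect derivatives within `s` at `z₀`.
  obtain ⟨V, hV, hVo, hzV⟩ := mem_nhds_iff.1 (inter_mem htgt (hcs'.eventually hev))
  have hzs : z₀ ∈ s := ⟨mem_extChartAt_target x, by rw [mem_preimage, hzx]; exact hx⟩
  have hfd : ContDiffAt ℝ ∞ f z₀ := by
    rw [← contMDiffAt_iff_contDiffAt]
    have h1 : ContMDiffAt 𝓘(ℝ, E) I ∞ (extChartAt I x).symm z₀ :=
      (contMDiffOn_extChartAt_symm x).contMDiffAt htgt
    have h2 : ContMDiffAt 𝓘(ℝ, E) I' ∞ (F ∘ (extChartAt I x).symm) z₀ :=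
      ContMDiffAt.comp z₀ (by rwa [hzx]) h1
    have h3 : ContMDiffAt I' 𝓘(ℝ, E') ∞ (extChartAt I' (F x))
        ((F ∘ (extChartAt I x).symm) z₀) := by
      rw [Function.comp_apply, hzx]
      exact contMDiffAt_extChartAt
    exact ContMDiffAt.comp z₀ h3 h2
  have hfz : f z₀ = extChartAt I' (F x) (F x) := by simp only [hf, Function.comp_apply, hzx]
  have hsV : UniqueDiffOn ℝ (s ∩ V) := hS.inter hVo
  have hfV : ∀ z ∈ V, DifferentiableAt ℝ f z := by
    intro z hz
    have h1 := (hV hz).2.1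
    rw [← mdifferentiableAt_iff_differentiableAt]
    exact MDifferentiableAt.comp (g := extChartAt I' (F x)) z
      (mdifferentiableAt_extChartAt_of_mem (hV hz).2.2.1)
      (MDifferentiableAt.comp (g := F) z h1 (mdifferentiableAt_extChartAt_symm (hV hz).1))
  have hw : ∀ z ∈ s ∩ V, fderivWithin ℝ f (s ∩ V) z = fderiv ℝ f z := fun z hz =>
    fderivWithin_eq_fderiv (hsV z hz) (hfV z hz.2)
  have hmaps : MapsTo f (s ∩ V) t := by
    intro z hz
    refine ⟨(extChartAt I' (F x)).map_source (hV hz.2).2.2.1, ?_⟩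
    have h1 := (extChartAt I' (F x)).left_inv (hV hz.2).2.2.1
    rw [mem_preimage]
    simp only [hf, Function.comp_apply, h1]
    exact (hV hz.2).2.2.2.1 hz.1.2
  have hdom : extDerivWithin (θ'.inChart x) s z₀ = extDerivWithin (θ'.inChart x) (s ∩ V) z₀ := by
    unfold extDerivWithin
    rw [fderivWithin_inter (hVo.mem_nhds hzV)]
  have hcongr : EqOn (θ'.inChart x) (fun z =>
      (θ.inChart (F x) (f z)).compContinuousLinearMap (fderivWithin ℝ f (s ∩ V) z)) (s ∩ V) := by
    intro z hz
    dsimp only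
    rw [hw z hz]
    have h1 := (hV hz.2).2
    refine Eq.trans ?_ (RawForm.inChart_pullback θ (hV hz.2).1 h1.1 h1.2.1)
    rw [RawForm.inChart_eq, RawForm.inChart_eq, h1.2.2.2 hz.1.2]
  have hθd : DifferentiableWithinAt ℝ (θ.inChart (F x)) t (f z₀) :=
    ((hθ (F x)).differentiableOn (by simp)) _ (hmaps ⟨hzs, hzV⟩)
  -- Naturality in vector spaces rests on the symmetry of the second derivative of `f` within the
  -- set. This is why `z₀` must lie in the closure of the interior.
  have main := extDerivWithin_pullback (r := ∞) hθd hfd.contDiffWithinAt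
    (by
      rw [minSmoothness_of_isRCLikeNormedField]
      exact WithTop.coe_le_coe.2 (le_top : (2 : ℕ∞) ≤ ⊤)) hsV
    (by
      rw [interior_inter, hVo.interior_eq, inter_comm]
      exact hVo.inter_closure ⟨hzV, hSc hzs⟩) ⟨hzs, hzV⟩ hmaps
  rw [RawForm.val_d, RawForm.val_pullback, RawForm.val_d, hdom,
    extDerivWithin_congr' hcongr ⟨hzs, hzV⟩, main, hw _ ⟨hzs, hzV⟩, hfz]
  -- Both sides are the derivative at `x` of the chart at `F x` composed with `F`.
  have key : (fderiv ℝ f z₀).comp (modelDeriv I 𝓘(ℝ, E) (extChartAt I x) x) =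
      (modelDeriv I' 𝓘(ℝ, E') (extChartAt I' (F x)) (F x)).comp (modelDeriv I I' F x) := by
    have h1 := mdifferentiableAt_extChartAt_of_mem (I := I) (mem_extChartAt_source x)
    have h2 := mdifferentiableAt_extChartAt_of_mem (I := I') (mem_extChartAt_source (F x))
    rw [← modelDeriv_eq_fderiv, ← modelDeriv_comp h2 (hF.mdifferentiableAt (by simp)),
      ← modelDeriv_comp (g := f) (f := extChartAt I x) ((hfV z₀ hzV).mdifferentiableAt) h1]
    apply modelDeriv_congr
    filter_upwards [extChartAt_source_mem_nhds (I := I) x] with y hy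
    simp only [hf, Function.comp_apply, (extChartAt I x).left_inv hy]
  ext v
  exact congrArg (extDerivWithin (θ.inChart (F x)) t (extChartAt I' (F x) (F x)))
    (funext fun i => congrArg (fun L : E →L[ℝ] E' => L (v i)) key)

/-- The definition of `d` uses a different chart at each point; naturality under the inverse of one
fixed chart shows that this chart computes `d` throughout its domain. Smoothness of `dθ` and all
later coordinate computations depend on this. -/
theorem RawForm.inChart_d {S : Set X} {θ : RawForm I X k} (hS : RegularDomain I S)
    (hθ : θ.SmoothOn S) {x₀ : X} {y : E} (hy : y ∈ chartDomain I S x₀) :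
    (RawForm.d S θ).inChart x₀ y = extDerivWithin (θ.inChart x₀) (chartDomain I S x₀) y := by
  have hF : ∀ᶠ z in 𝓝 y, ContMDiffAt 𝓘(ℝ, E) I ∞ (extChartAt I x₀).symm z := by
    have ho : IsOpen (extChartAt I x₀).target := isOpen_extChartAt_target x₀
    filter_upwards [ho.mem_nhds hy.1] with z hz
    exact (contMDiffOn_extChartAt_symm x₀).contMDiffAt (ho.mem_nhds hz)
  have key := RawForm.d_pullback (I := 𝓘(ℝ, E)) (I' := I) (F := (extChartAt I x₀).symm)
    (S := chartDomain I S x₀) (T := S) (θ := θ)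
    (θ' := RawForm.pullback 𝓘(ℝ, E) (extChartAt I x₀).symm θ) (x := y)
    (by rw [chartDomain_model]; exact (hS x₀).1) (by rw [chartDomain_model]; exact (hS x₀).2)
    hθ hy hF (eventually_mem_nhdsWithin.mono fun z hz => hz.2) (Eventually.of_forall fun _ => rfl)
  have h2 : (RawForm.pullback 𝓘(ℝ, E) (extChartAt I x₀).symm θ).val = θ.inChart x₀ :=
    funext fun z => (RawForm.inChart_eq θ x₀ z).symm
  rw [RawForm.val_d_model, h2] at key
  rw [key, RawForm.inChart_eq, RawForm.val_pullback]

theorem RawForm.SmoothOn.d {S : Set X} {θ : RawForm I X k} (hS : RegularDomain I S)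
    (hθ : θ.SmoothOn S) : (RawForm.d S θ).SmoothOn S := by
  intro x₀
  have h : ContDiffOn ℝ ∞ (extDerivWithin (θ.inChart x₀) (chartDomain I S x₀))
      (chartDomain I S x₀) :=
    ContDiff.comp_contDiffOn
      (g := ContinuousAlternatingMap.alternatizeUncurryFinCLM ℝ E ℝ (n := k))
      (ContinuousLinearMap.contDiff _)
      ((hθ x₀).fderivWithin (m := ∞) (hS x₀).1 (by simp))
  exact h.congr fun y hy => RawForm.inChart_d hS hθ hy

-- Off a closed `S` the point is outside the closure of the chart domain, where `fderivWithin` takes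
-- its default value `0`. Thus `d` preserves the convention of extending forms by zero.
omit [IsManifold I ∞ X] [I.Boundaryless] in
theorem RawForm.d_eq_zero_of_notMem {S : Set X} (hS : IsClosed S) (θ : RawForm I X k) {x : X}
    (hx : x ∉ S) : RawForm.d S θ x = 0 := by
  have h : extChartAt I x x ∉ closure (chartDomain I S x) := by
    have h1 : ∀ᶠ z in 𝓝 (extChartAt I x x), (extChartAt I x).symm z ∉ S := by
      refine (continuousAt_extChartAt_symm (I := I) x).eventually (p := (· ∉ S)) ?_
      rw [extChartAt_to_inv]
      exact hS.isOpen_compl.mem_nhds hx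
    intro hc
    obtain ⟨z, hz, hz'⟩ := (mem_closure_iff_frequently.1 hc).and_eventually h1 |>.exists
    exact hz' hz.2
  have h2 : extDerivWithin (θ.inChart x) (chartDomain I S x) (extChartAt I x x) = 0 := by
    unfold extDerivWithin
    rw [fderivWithin_zero_of_notMem_closure h]
    exact map_zero (ContinuousAlternatingMap.alternatizeUncurryFinCLM ℝ E ℝ)
  change (RawForm.d S θ).val x = 0
  rw [RawForm.val_d, h2]
  rfl

theorem RawForm.d_mem_smoothForms {S : Set X} {θ : RawForm I X k} (hS : RegularDomain I S)
    (hSc : IsClosed S) (hθ : θ ∈ smoothForms I S k) : RawForm.d S θ ∈ smoothForms I S (k + 1) :=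
  ⟨hθ.1.d hS, fun _ hx => RawForm.d_eq_zero_of_notMem hSc θ hx⟩

end
end FormsLemmas
end

noncomputable section

/-! ### The standard simplices -/

theorem mem_simplex_iff {n : ℕ} {t : Fin n → ℝ} :
    t ∈ simplex n ↔ (∀ i, 0 ≤ t i) ∧ ∑ i, t i ≤ 1 := by
  simp only [simplex, stdSimplex, mem_ofPred_eq, bary, Fin.forall_fin_succ, Fin.cons_zero,
    Fin.cons_succ, Fin.sum_univ_succ]
  constructor
  · rintro ⟨⟨h1, h2⟩, -⟩
    exact ⟨h2, by linarith⟩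
  · rintro ⟨h1, h2⟩
    exact ⟨⟨by linarith, h1⟩, by ring⟩

theorem sum_bary {n : ℕ} (t : Fin n → ℝ) : ∑ i, bary t i = 1 := by
  simp [bary, Fin.sum_univ_succ]

theorem bary_nonneg {n : ℕ} {t : Fin n → ℝ} (ht : t ∈ simplex n) (i : Fin (n + 1)) :
    0 ≤ bary t i := ht.1 i

/-- A point of the simplex is determined by its barycentric coordinates. -/
theorem tail_mem_simplex {n : ℕ} {b : Fin (n + 1) → ℝ} (h0 : ∀ i, 0 ≤ b i) (h1 : ∑ i, b i = 1) :
    Fin.tail b ∈ simplex n := by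
  rw [mem_simplex_iff]
  refine ⟨fun i => h0 _, ?_⟩
  rw [Fin.sum_univ_succ] at h1
  have := h0 0
  simp only [Fin.tail]
  linarith

theorem convex_simplex (n : ℕ) : Convex ℝ (simplex n) := by
  intro x hx y hy a b ha hb hab
  rw [mem_simplex_iff] at *
  refine ⟨fun i => ?_, ?_⟩
  · have := hx.1 i
    have := hy.1 i
    simp only [Pi.add_apply, Pi.smul_apply, smul_eq_mul]
    positivity
  · simp only [Pi.add_apply, Pi.smul_apply, smul_eq_mul, Finset.sum_add_distrib, ← Finset.mul_sum]
    nlinarith [hx.2, hy.2]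

theorem isClosed_simplex (n : ℕ) : IsClosed (simplex n) := by
  have : simplex n = (⋂ i, {t : Fin n → ℝ | 0 ≤ t i}) ∩ {t | ∑ i, t i ≤ 1} := by
    ext t
    simp [mem_simplex_iff]
  rw [this]
  exact (isClosed_iInter fun i => isClosed_le continuous_const (continuous_apply i)).inter
    (isClosed_le (by fun_prop) continuous_const)

theorem isCompact_simplex (n : ℕ) : IsCompact (simplex n) := by
  refine (isCompact_Icc (a := (0 : Fin n → ℝ)) (b := 1)).of_isClosed_subset (isClosed_simplex n) ?_
  intro t ht
  rw [mem_simplex_iff] at ht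
  exact ⟨ht.1, fun i => (Finset.single_le_sum (fun j _ => ht.1 j) (Finset.mem_univ i)).trans ht.2⟩

theorem interior_simplex_nonempty (n : ℕ) : (interior (simplex n)).Nonempty := by
  let U : Set (Fin n → ℝ) := (⋂ i, {t : Fin n → ℝ | 0 < t i}) ∩ {t | ∑ i, t i < 1}
  have hU : IsOpen U :=
    (isOpen_iInter_of_finite fun i => isOpen_lt continuous_const (continuous_apply i)).inter
      (isOpen_lt (by fun_prop) continuous_const)
  refine ⟨fun _ => 1 / (n + 1 : ℝ), interior_maximal (t := U) ?_ hU ⟨?_, ?_⟩⟩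
  · rintro t ⟨h1, h2⟩
    rw [mem_iInter] at h1
    exact mem_simplex_iff.2 ⟨fun i => le_of_lt (h1 i), le_of_lt h2⟩
  · rw [mem_iInter]
    intro i
    simp only [mem_ofPred_eq]
    positivity
  · simp only [mem_ofPred_eq, Finset.sum_const, Finset.card_univ, Fintype.card_fin, nsmul_eq_mul]
    rw [mul_one_div, div_lt_one (by positivity)]
    linarith

theorem uniqueDiffOn_simplex (n : ℕ) : UniqueDiffOn ℝ (simplex n) :=
  uniqueDiffOn_convex (convex_simplex n) (interior_simplex_nonempty n)

theorem simplex_subset_closure_interior (n : ℕ) : simplex n ⊆ closure (interior (simplex n)) := by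
  rw [(convex_simplex n).closure_interior_eq_closure_of_nonempty_interior
    (interior_simplex_nonempty n)]
  exact subset_closure

/-! ### Faces and degeneracies -/

theorem mapsTo_simplexFace {n : ℕ} (j : Fin (n + 2)) :
    MapsTo (simplexFace j) (simplex n) (simplex (n + 1)) := by
  intro t ht
  refine tail_mem_simplex (fun i => ?_) ?_
  · refine Fin.succAboveCases j ?_ (fun i => ?_) i
    · simp
    · simpa using bary_nonneg ht i
  · rw [Fin.sum_univ_succAbove _ j]
    simp [sum_bary]

theorem mapsTo_simplexDegen {n : ℕ} (j : Fin (n + 1)) :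
    MapsTo (simplexDegen j) (simplex (n + 1)) (simplex n) := by
  intro t ht
  refine tail_mem_simplex (fun i => Finset.sum_nonneg fun l _ => bary_nonneg ht l) ?_
  rw [Finset.sum_fiberwise (s := Finset.univ) (g := fun l => j.predAbove l) (f := bary t), sum_bary]

theorem simplexFace_succ {n : ℕ} (j : Fin (n + 1)) (t : Fin n → ℝ) :
    simplexFace j.succ t = j.insertNth (α := fun _ => ℝ) 0 t := by
  funext i
  simp only [simplexFace, Fin.tail]
  refine Fin.succAboveCases j ?_ (fun i => ?_) i
  · simp
  · rw [← Fin.succ_succAbove_succ, Fin.insertNth_apply_succAbove, Fin.insertNth_apply_succAbove]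
    simp [bary]

theorem simplexFace_zero {n : ℕ} (t : Fin n → ℝ) : simplexFace 0 t = bary t := by
  funext i
  simp [simplexFace, Fin.tail]

theorem contDiff_bary (n : ℕ) : ContDiff ℝ ∞ (bary : (Fin n → ℝ) → _) := by
  rw [contDiff_pi]
  intro i
  refine Fin.cases ?_ (fun i => ?_) i
  · simp only [bary, Fin.cons_zero]
    fun_prop
  · simp only [bary, Fin.cons_succ]
    fun_prop

theorem contDiff_simplexFace {n : ℕ} (j : Fin (n + 2)) : ContDiff ℝ ∞ (simplexFace (n := n) j) := by
  refine Fin.cases ?_ (fun j => ?_) j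
  · rw [funext simplexFace_zero]
    exact contDiff_bary n
  · rw [funext (simplexFace_succ j), contDiff_pi]
    intro i
    refine Fin.succAboveCases j ?_ (fun i => ?_) i
    · simp only [Fin.insertNth_apply_same]
      fun_prop
    · simp only [Fin.insertNth_apply_succAbove]
      fun_prop

theorem contDiff_simplexDegen {n : ℕ} (j : Fin (n + 1)) :
    ContDiff ℝ ∞ (simplexDegen (n := n) j) := by
  rw [contDiff_pi]
  intro i
  simp only [simplexDegen, Fin.tail]
  exact ContDiff.sum fun l _ => contDiff_pi.1 (contDiff_bary (n + 1)) l

/-! ### The exterior derivative on the realization -/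

variable {M : SimplicialObject SmoothMfd.{u}}

theorem chartDomain_simplexProd {n m : ℕ} (q : (Fin n → ℝ) × level M m) :
    chartDomain (prodModel M n m) (simplexProd M n m) q =
      simplex n ×ˢ (extChartAt (𝓡 (level M m).dim) q.2).target := by
  ext z
  simp only [chartDomain, extChartAt_prod]
  simp [and_comm, chartAt_self_eq]

theorem regularDomain_simplexProd (n m : ℕ) :
    RegularDomain (prodModel M n m) (simplexProd M n m) := by
  intro q
  have ho : IsOpen (extChartAt (𝓡 (level M m).dim) q.2).target := isOpen_extChartAt_target q.2
  rw [chartDomain_simplexProd]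
  refine ⟨(uniqueDiffOn_simplex n).prod ho.uniqueDiffOn, ?_⟩
  rw [interior_prod_eq, closure_prod_eq]
  exact prod_mono (simplex_subset_closure_interior n) (ho.interior_eq.symm ▸ subset_closure)

theorem isClosed_simplexProd (n m : ℕ) : IsClosed (simplexProd M n m) :=
  (isClosed_simplex n).prod isClosed_univ

theorem chartDomain_univ {E H X : Type*} [NormedAddCommGroup E] [NormedSpace ℝ E]
    [TopologicalSpace H] (I : ModelWithCorners ℝ E H) [TopologicalSpace X] [ChartedSpace H X]
    (x : X) : chartDomain I univ x = (extChartAt I x).target := by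
  simp [chartDomain]

theorem regularDomain_univ {E H X : Type*} [NormedAddCommGroup E] [NormedSpace ℝ E]
    [TopologicalSpace H] (I : ModelWithCorners ℝ E H) [I.Boundaryless] [TopologicalSpace X]
    [ChartedSpace H X] : RegularDomain I (univ : Set X) := by
  intro x
  have ho : IsOpen (extChartAt I x).target := isOpen_extChartAt_target x
  rw [chartDomain_univ]
  exact ⟨ho.uniqueDiffOn, ho.interior_eq.symm ▸ subset_closure⟩

theorem contMDiff_prodMap_id {n m : ℕ} (k : ℕ) {f : (Fin n → ℝ) → (Fin m → ℝ)}
    (hf : ContDiff ℝ ∞ f) :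
    ContMDiff (prodModel M n k) (prodModel M m k) ∞
      (Prod.map f id : (Fin n → ℝ) × level M k → (Fin m → ℝ) × level M k) :=
  hf.contMDiff.prodMap contMDiff_id

theorem contMDiff_id_prodMap {n m : ℕ} (k : ℕ) (f : level M n ⟶ level M m) :
    ContMDiff (prodModel M k n) (prodModel M k m) ∞
      (Prod.map id f.toFun : (Fin k → ℝ) × level M n → (Fin k → ℝ) × level M m) :=
  contMDiff_id.prodMap f.smooth

/-- Both gluing conditions equate pullbacks along two smooth maps, so this single lemma transfers
either of them from `φ` to `dφ`. -/
theorem RawForm.pullback_d_eq {n m a b a' b' p : ℕ}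
    {F : (Fin n → ℝ) × level M m → (Fin a → ℝ) × level M b}
    {G : (Fin n → ℝ) × level M m → (Fin a' → ℝ) × level M b'}
    (hF : ContMDiff (prodModel M n m) (prodModel M a b) ∞ F)
    (hG : ContMDiff (prodModel M n m) (prodModel M a' b') ∞ G)
    (hFm : MapsTo F (simplexProd M n m) (simplexProd M a b))
    (hGm : MapsTo G (simplexProd M n m) (simplexProd M a' b'))
    {θ : RawForm (prodModel M a b) ((Fin a → ℝ) × level M b) p}
    {η : RawForm (prodModel M a' b') ((Fin a' → ℝ) × level M b') p}
    (hθ : θ.SmoothOn (simplexProd M a b)) (hη : η.SmoothOn (simplexProd M a' b'))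
    (h : ∀ q ∈ simplexProd M n m, RawForm.pullback (prodModel M n m) F θ q =
      RawForm.pullback (prodModel M n m) G η q) {q : (Fin n → ℝ) × level M m}
    (hq : q ∈ simplexProd M n m) :
    RawForm.pullback (prodModel M n m) F (RawForm.d (simplexProd M a b) θ) q =
      RawForm.pullback (prodModel M n m) G (RawForm.d (simplexProd M a' b') η) q := by
  have hr := regularDomain_simplexProd (M := M) n m q
  have h1 := RawForm.d_pullback (θ' := RawForm.pullback (prodModel M n m) F θ) hr.1 hr.2 hθ hq
    (Eventually.of_forall fun y => hF y) (eventually_mem_nhdsWithin.mono hFm)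
    (Eventually.of_forall fun _ => rfl)
  -- The form `F^* θ` serves as `θ'` for `G` too: the two pullbacks need to agree only on
  -- `simplexProd M n m`, since derivatives are taken within it.
  have h2 := RawForm.d_pullback (θ' := RawForm.pullback (prodModel M n m) F θ) hr.1 hr.2 hη hq
    (Eventually.of_forall fun y => hG y) (eventually_mem_nhdsWithin.mono hGm)
    (eventually_mem_nhdsWithin.mono h)
  exact h1.symm.trans h2

theorem RawFamily.d_mem_realizationForms {p : ℕ} {φ : RawFamily M p}
    (hφ : φ ∈ realizationForms M p) : φ.d ∈ realizationForms M (p + 1) := by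
  refine ⟨fun n => RawForm.d_mem_smoothForms (regularDomain_simplexProd n n)
    (isClosed_simplexProd n n) (hφ.1 n), fun n j q hq => ?_, fun n j q hq => ?_⟩
  · exact RawForm.pullback_d_eq (contMDiff_prodMap_id _ (contDiff_simplexFace j))
      (contMDiff_id_prodMap n (M.δ j) :) (fun q hq => ⟨mapsTo_simplexFace j hq.1, mem_univ _⟩)
      (fun q hq => ⟨hq.1, mem_univ _⟩) (hφ.1 (n + 1)).1 (hφ.1 n).1 (hφ.2.1 n j) hq
  · exact RawForm.pullback_d_eq (contMDiff_prodMap_id _ (contDiff_simplexDegen j))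
      (contMDiff_id_prodMap (n + 1) (M.σ j) :) (fun q hq => ⟨mapsTo_simplexDegen j hq.1, mem_univ _⟩)
      (fun q hq => ⟨hq.1, mem_univ _⟩) (hφ.1 n).1 (hφ.1 (n + 1)).1 (hφ.2.2 n j) hq
end

noncomputable section

/-! ### Integrals depending on a parameter -/

section ParametricIntegral

variable {E F G : Type} [NormedAddCommGroup E] [NormedSpace ℝ E] [MeasurableSpace E] [BorelSpace E]
  [NormedAddCommGroup F] [NormedSpace ℝ F] [ProperSpace F]
  [NormedAddCommGroup G] [NormedSpace ℝ G] {μ : Measure E} [IsFiniteMeasureOnCompacts μ]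
  {K : Set E} {U : Set F} {g : E × F → G}

omit [NormedSpace ℝ E] [NormedSpace ℝ F] [ProperSpace F] [NormedSpace ℝ G] in
theorem integrableOn_slice (hK : IsCompact K) (hg : ContinuousOn g (K ×ˢ U)) {y : F} (hy : y ∈ U) :
    IntegrableOn (fun t => g (t, y)) K μ := by
  refine ContinuousOn.integrableOn_compact' hK hK.measurableSet ?_
  exact hg.comp (by fun_prop) fun t ht => ⟨ht, hy⟩

/-- Dominated differentiation, with smoothness assumed only up to the boundary of `K`. The
derivative within `K ×ˢ U` becomes a full derivative in the parameter because `U` is open. -/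
theorem hasFDerivAt_setIntegral [CompleteSpace G] (hK : IsCompact K) (hKu : UniqueDiffOn ℝ K)
    (hU : IsOpen U) (hg : ContDiffOn ℝ 1 g (K ×ˢ U)) {y : F} (hy : y ∈ U) :
    HasFDerivAt (fun y => ∫ t in K, g (t, y) ∂μ)
      (∫ t in K, (fderivWithin ℝ g (K ×ˢ U) (t, y)).comp (ContinuousLinearMap.inr ℝ E F) ∂μ) y := by
  have hu : UniqueDiffOn ℝ (K ×ˢ U) := hKu.prod hU.uniqueDiffOn
  have hc : ContinuousOn (fun q => (fderivWithin ℝ g (K ×ˢ U) q).comp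
      (ContinuousLinearMap.inr ℝ E F)) (K ×ˢ U) :=
    (hg.continuousOn_fderivWithin hu (by simp)).clm_comp continuousOn_const
  -- Closed balls are compact in the proper space `F`, so the continuous partial derivative is
  -- bounded on `K` times a ball; a constant dominates.
  obtain ⟨r, hr, hrU⟩ := Metric.nhds_basis_closedBall.mem_iff.1 (hU.mem_nhds hy)
  obtain ⟨C, hC⟩ := (hK.prod (isCompact_closedBall y r)).exists_bound_of_continuousOn
    (hc.mono (prod_mono_right hrU))
  refine hasFDerivAt_integral_of_dominated_of_fderiv_le (μ := μ.restrict K) (bound := fun _ => C)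
    (F' := fun z t => (fderivWithin ℝ g (K ×ˢ U) (t, z)).comp (ContinuousLinearMap.inr ℝ E F))
    (Metric.closedBall_mem_nhds y hr) ?_ ?_ ?_ ?_ ?_ ?_
  · filter_upwards [hU.mem_nhds hy] with z hz
    exact (integrableOn_slice hK hg.continuousOn hz).aestronglyMeasurable
  · exact integrableOn_slice hK hg.continuousOn hy
  · exact (integrableOn_slice hK hc hy).aestronglyMeasurable
  · filter_upwards [ae_restrict_mem hK.measurableSet] with t ht z hz
    exact hC (t, z) ⟨ht, hz⟩
  · have : IsFiniteMeasure (μ.restrict K) := ⟨by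
      rw [Measure.restrict_apply_univ]; exact hK.measure_lt_top⟩
    exact integrable_const C
  · filter_upwards [ae_restrict_mem hK.measurableSet] with t ht z hz
    have h1 := (hg.differentiableOn (by simp) (t, z) ⟨ht, hrU hz⟩).hasFDerivWithinAt
    have h2 : HasFDerivWithinAt (fun z : F => (t, z)) (ContinuousLinearMap.inr ℝ E F) U z :=
      (hasFDerivAt_prodMk_right t z).hasFDerivWithinAt
    exact (h1.comp z h2 fun w hw => ⟨ht, hw⟩).hasFDerivAt (hU.mem_nhds (hrU hz))

theorem clm_fderiv_setIntegral_apply [CompleteSpace G] (hK : IsCompact K) (hKu : UniqueDiffOn ℝ K)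
    (hU : IsOpen U) (hg : ContDiffOn ℝ 1 g (K ×ˢ U)) {y : F} (hy : y ∈ U) (v : F) (L : G →L[ℝ] ℝ) :
    L (fderiv ℝ (fun y => ∫ t in K, g (t, y) ∂μ) y v) =
      ∫ t in K, L (fderivWithin ℝ g (K ×ˢ U) (t, y) (0, v)) ∂μ := by
  have hu : UniqueDiffOn ℝ (K ×ˢ U) := hKu.prod hU.uniqueDiffOn
  have hc : ContinuousOn (fun q => (fderivWithin ℝ g (K ×ˢ U) q).comp
      (ContinuousLinearMap.inr ℝ E F)) (K ×ˢ U) :=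
    (hg.continuousOn_fderivWithin hu (by simp)).clm_comp continuousOn_const
  have hI : IntegrableOn (fun t => (fderivWithin ℝ g (K ×ˢ U) (t, y)).comp
      (ContinuousLinearMap.inr ℝ E F)) K μ := integrableOn_slice hK hc hy
  rw [(hasFDerivAt_setIntegral hK hKu hU hg hy).fderiv, ContinuousLinearMap.integral_apply hI,
    ← L.integral_comp_comm (hI.apply_continuousLinearMap v)]
  rfl

/-- Induction on `m`: the derivative of the integral is the integral of the partial derivative. The
target `G` varies in the induction because that derivative takes values in `F →L[ℝ] G`. -/
theorem contDiffOn_setIntegral_nat (hK : IsCompact K) (hKu : UniqueDiffOn ℝ K) (hU : IsOpen U)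
    (m : ℕ) : ∀ {G : Type} [NormedAddCommGroup G] [NormedSpace ℝ G] [CompleteSpace G]
      {g : E × F → G}, ContDiffOn ℝ m g (K ×ˢ U) →
      ContDiffOn ℝ m (fun y => ∫ t in K, g (t, y) ∂μ) U := by
  induction m with
  | zero =>
    intro G _ _ _ g hg y hy
    rw [Nat.cast_zero] at hg ⊢
    refine (contDiffOn_zero.2 ?_) y hy
    have hc := hg.continuousOn
    intro y hy
    obtain ⟨r, hr, hrU⟩ := Metric.nhds_basis_closedBall.mem_iff.1 (hU.mem_nhds hy)
    obtain ⟨C, hC⟩ := (hK.prod (isCompact_closedBall y r)).exists_bound_of_continuousOn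
      (hc.mono (prod_mono_right hrU))
    have : IsFiniteMeasure (μ.restrict K) := ⟨by
      rw [Measure.restrict_apply_univ]; exact hK.measure_lt_top⟩
    refine ContinuousAt.continuousWithinAt ?_
    refine continuousAt_of_dominated (bound := fun _ => C) ?_ ?_ (integrable_const C) ?_
    · filter_upwards [hU.mem_nhds hy] with z hz
      exact (integrableOn_slice hK hc hz).aestronglyMeasurable
    · filter_upwards [Metric.closedBall_mem_nhds y hr] with z hz
      filter_upwards [ae_restrict_mem hK.measurableSet] with t ht
      exact hC (t, z) ⟨ht, hz⟩
    · filter_upwards [ae_restrict_mem hK.measurableSet] with t ht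
      have : ContinuousOn (fun z => g (t, z)) U := hc.comp (by fun_prop) fun z hz => ⟨ht, hz⟩
      exact this.continuousAt (hU.mem_nhds hy)
  | succ m ih =>
    intro G _ _ _ g hg
    have hu : UniqueDiffOn ℝ (K ×ˢ U) := hKu.prod hU.uniqueDiffOn
    have hg1 : ContDiffOn ℝ 1 g (K ×ˢ U) := hg.of_le (by exact_mod_cast Nat.le_add_left 1 m)
    rw [Nat.cast_succ, contDiffOn_succ_iff_fderiv_of_isOpen hU]
    refine ⟨fun y hy => (hasFDerivAt_setIntegral hK hKu hU hg1
      hy).differentiableAt.differentiableWithinAt, by simp, ?_⟩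
    have h := ih (g := fun q => (fderivWithin ℝ g (K ×ˢ U) q).comp
      (ContinuousLinearMap.inr ℝ E F))
      ((hg.fderivWithin hu (by simp)).clm_comp contDiffOn_const)
    exact h.congr fun y hy => (hasFDerivAt_setIntegral hK hKu hU hg1 hy).fderiv

theorem contDiffOn_setIntegral [CompleteSpace G] (hK : IsCompact K) (hKu : UniqueDiffOn ℝ K)
    (hU : IsOpen U) (hg : ContDiffOn ℝ ∞ g (K ×ˢ U)) :
    ContDiffOn ℝ ∞ (fun y => ∫ t in K, g (t, y) ∂μ) U :=
  contDiffOn_infty.2 fun m => contDiffOn_setIntegral_nat hK hKu hU m (contDiffOn_infty.1 hg m)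

end ParametricIntegral
end

noncomputable section

/-! ### Integration over a simplex -/

theorem insertNth_mem_simplex_iff {n : ℕ} (i : Fin (n + 1)) (x : ℝ) (s : Fin n → ℝ) :
    i.insertNth (α := fun _ => ℝ) x s ∈ simplex (n + 1) ↔
      s ∈ simplex n ∧ x ∈ Icc 0 (1 - ∑ a, s a) := by
  rw [mem_simplex_iff, mem_simplex_iff, Fin.forall_iff_succAbove i, Fin.sum_univ_succAbove _ i]
  simp only [Fin.insertNth_apply_same, Fin.insertNth_apply_succAbove, mem_Icc]
  constructor
  · rintro ⟨⟨h1, h2⟩, h3⟩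
    exact ⟨⟨h2, by linarith⟩, h1, by linarith⟩
  · rintro ⟨⟨h1, h2⟩, h3, h4⟩
    exact ⟨⟨h3, h1⟩, by linarith⟩

/-- Integration over the simplex, one coordinate first. -/
theorem setIntegral_simplex_succ {n : ℕ} (i : Fin (n + 1)) {g : (Fin (n + 1) → ℝ) → ℝ}
    (hg : IntegrableOn g (simplex (n + 1))) :
    ∫ t in simplex (n + 1), g t =
      ∫ s in simplex n, ∫ x in (0 : ℝ)..(1 - ∑ a, s a), g (i.insertNth (α := fun _ => ℝ) x s) := by
  have hm := (isClosed_simplex (n + 1)).measurableSet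
  have hmp := (volume_preserving_piFinSuccAbove (fun _ : Fin (n + 1) => ℝ) i).symm
  rw [← integral_indicator hm, ← integral_indicator (isClosed_simplex n).measurableSet,
    ← hmp.integral_comp' (g := (simplex (n + 1)).indicator g)]
  have hint : Integrable (fun p : ℝ × (Fin n → ℝ) => (simplex (n + 1)).indicator g
      ((MeasurableEquiv.piFinSuccAbove (fun _ : Fin (n + 1) => ℝ) i).symm p))
      ((volume : Measure ℝ).prod volume) :=
    (hmp.integrable_comp_emb (MeasurableEquiv.measurableEmbedding _)).2
      ((integrable_indicator_iff hm).2 hg)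
  refine (integral_prod_symm _ hint).trans (integral_congr_ae (Eventually.of_forall fun s => ?_))
  dsimp only
  have hval : ∀ x : ℝ, (MeasurableEquiv.piFinSuccAbove (fun _ : Fin (n + 1) => ℝ) i).symm (x, s) =
      i.insertNth (α := fun _ => ℝ) x s := fun x => rfl
  simp only [hval]
  by_cases hs : s ∈ simplex n
  · rw [indicator_of_mem hs, intervalIntegral.integral_of_le
      (by linarith [(mem_simplex_iff.1 hs).2]), ← integral_Icc_eq_integral_Ioc,
      ← integral_indicator measurableSet_Icc]
    congr 1
    funext x
    by_cases hx : x ∈ Icc 0 (1 - ∑ a, s a)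
    · rw [indicator_of_mem hx, indicator_of_mem ((insertNth_mem_simplex_iff i x s).2 ⟨hs, hx⟩)]
    · rw [indicator_of_notMem hx, indicator_of_notMem]
      exact fun h => hx ((insertNth_mem_simplex_iff i x s).1 h).2
  -- Over a point outside the smaller simplex the slice is empty.
  · rw [indicator_of_notMem hs]
    refine integral_eq_zero_of_ae (Eventually.of_forall fun x => ?_)
    exact indicator_of_notMem (fun h => hs ((insertNth_mem_simplex_iff i x s).1 h).1) _

theorem hasDerivAt_insertNth {n : ℕ} (i : Fin (n + 1)) (s : Fin n → ℝ) (x : ℝ) :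
    HasDerivAt (fun x => i.insertNth (α := fun _ => ℝ) x s) (Pi.single i 1) x := by
  rw [hasDerivAt_pi]
  intro k
  refine Fin.succAboveCases i ?_ (fun k => ?_) k
  · simpa using hasDerivAt_id' x
  · simpa [Fin.succAbove_ne] using hasDerivAt_const x (s k)

/-- Fubini followed by the fundamental theorem of calculus on each segment in direction `i`. The
upper ends of the segments fill the slanted face, the lower ends the face where coordinate `i`
vanishes. -/
theorem setIntegral_simplex_fderivWithin {n : ℕ} (i : Fin (n + 1)) {f : (Fin (n + 1) → ℝ) → ℝ}
    (hf : ContDiffOn ℝ 1 f (simplex (n + 1))) :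
    ∫ t in simplex (n + 1), fderivWithin ℝ f (simplex (n + 1)) t (Pi.single i 1) =
      ∫ s in simplex n, (f (i.insertNth (α := fun _ => ℝ) (1 - ∑ a, s a) s) -
        f (i.insertNth (α := fun _ => ℝ) 0 s)) := by
  have hc : ContinuousOn (fun t => fderivWithin ℝ f (simplex (n + 1)) t (Pi.single i 1))
      (simplex (n + 1)) :=
    (hf.continuousOn_fderivWithin (uniqueDiffOn_simplex _) (by simp)).clm_apply continuousOn_const
  rw [setIntegral_simplex_succ i (hc.integrableOn_compact (isCompact_simplex _))]
  refine setIntegral_congr_fun (isClosed_simplex n).measurableSet fun s hs => ?_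
  have hle : (0 : ℝ) ≤ 1 - ∑ a, s a := by linarith [(mem_simplex_iff.1 hs).2]
  have hcurve : ContinuousOn (fun x => i.insertNth (α := fun _ => ℝ) x s)
      (Icc 0 (1 - ∑ a, s a)) :=
    fun x _ => (hasDerivAt_insertNth i s x).continuousAt.continuousWithinAt
  have hmaps : MapsTo (fun x => i.insertNth (α := fun _ => ℝ) x s) (Icc 0 (1 - ∑ a, s a))
      (simplex (n + 1)) := fun x hx => (insertNth_mem_simplex_iff i x s).2 ⟨hs, hx⟩
  refine intervalIntegral.integral_eq_sub_of_hasDerivAt_of_le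
    (f := fun x => f (i.insertNth (α := fun _ => ℝ) x s)) hle
    (hf.continuousOn.comp hcurve hmaps) (fun x hx => ?_) ?_
  · have h1 := (hf.differentiableOn (by simp) _
      (hmaps (Ioo_subset_Icc_self hx))).hasFDerivWithinAt
    exact (h1.comp_hasDerivWithinAt x (hasDerivAt_insertNth i s x).hasDerivWithinAt
      hmaps).hasDerivAt (Icc_mem_nhds hx.1 hx.2)
  · apply ContinuousOn.intervalIntegrable
    rw [uIcc_of_le hle]
    exact hc.comp hcurve hmaps

/-- Two adjacent coordinates can be inserted in either order. This compares neighbouring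
parametrizations of the slanted face. -/
theorem insertNth_castSucc_insertNth {m : ℕ} (k : Fin (m + 1)) (x y : ℝ) (r : Fin m → ℝ) :
    k.castSucc.insertNth (α := fun _ => ℝ) y (k.insertNth (α := fun _ => ℝ) x r) =
      k.succ.insertNth (α := fun _ => ℝ) x (k.insertNth (α := fun _ => ℝ) y r) := by
  rw [Fin.insertNth_eq_iff]
  constructor
  · rw [← Fin.succAbove_succ_self k, Fin.insertNth_apply_succAbove, Fin.insertNth_apply_same]
  · funext l
    refine Fin.succAboveCases k ?_ (fun l => ?_) l
    · simp [Fin.removeNth]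
    · simp only [Fin.removeNth, Fin.insertNth_apply_succAbove]
      have h : k.castSucc.succAbove (k.succAbove l) = k.succ.succAbove (k.succAbove l) := by
        ext
        simp only [Fin.succAbove, Fin.lt_def, Fin.val_castSucc, Fin.val_succ]
        split_ifs <;> simp_all <;> omega
      rw [h, Fin.insertNth_apply_succAbove, Fin.insertNth_apply_succAbove]

/-- All ways to parametrize the face opposite to the vertex `0` have the same integrals. -/
theorem setIntegral_simplex_insertNth {n : ℕ} (i : Fin (n + 1)) {h : (Fin (n + 1) → ℝ) → ℝ}
    (hh : ContinuousOn h (simplex (n + 1))) :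
    ∫ s in simplex n, h (i.insertNth (α := fun _ => ℝ) (1 - ∑ a, s a) s) =
      ∫ s in simplex n, h (bary s) := by
  have hint : ∀ i : Fin (n + 1), IntegrableOn
      (fun s => h (i.insertNth (α := fun _ => ℝ) (1 - ∑ a, s a) s)) (simplex n) := by
    intro i
    refine ContinuousOn.integrableOn_compact (isCompact_simplex n) ?_
    refine hh.comp (Continuous.continuousOn ?_) fun s hs => ?_
    · refine continuous_pi fun k => ?_
      refine Fin.succAboveCases i ?_ (fun k => ?_) k
      · simp only [Fin.insertNth_apply_same]
        fun_prop
      · simp only [Fin.insertNth_apply_succAbove]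
        fun_prop
    · exact (insertNth_mem_simplex_iff i _ s).2
        ⟨hs, by linarith [(mem_simplex_iff.1 hs).2], le_rfl⟩
  induction i using Fin.induction with
  | zero =>
    simp only [Fin.insertNth_zero']
    rfl
  | succ k ih =>
    rw [← ih]
    -- A successor index forces `n > 0`, so there is a coordinate to integrate first.
    obtain _ | m := n
    · exact k.elim0
    rw [setIntegral_simplex_succ k (hint _), setIntegral_simplex_succ k (hint _)]
    refine setIntegral_congr_fun (isClosed_simplex m).measurableSet fun r hr => ?_
    set c : ℝ := 1 - ∑ a, r a with hc
    have hsum : ∀ x, 1 - ∑ a, k.insertNth (α := fun _ => ℝ) x r a = c - x := fun x => by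
      rw [Fin.sum_univ_succAbove _ k]
      simp only [Fin.insertNth_apply_same, Fin.insertNth_apply_succAbove, hc]
      ring
    simp only [hsum]
    -- With the other coordinates `r` fixed, the coordinates at `k` and `k + 1` have sum `c` on the
    -- slanted face. The two parametrizations differ by which of them is free, hence by the
    -- substitution `x ↦ c - x` on `[0, c]`.
    have h1 : ∀ x, h (k.succ.insertNth (α := fun _ => ℝ) (c - x)
        (k.insertNth (α := fun _ => ℝ) x r)) =
        (fun y => h (k.castSucc.insertNth (α := fun _ => ℝ) (c - y)
          (k.insertNth (α := fun _ => ℝ) y r))) (c - x) := fun x => by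
      dsimp only
      rw [sub_sub_cancel, insertNth_castSucc_insertNth]
    simp only [h1]
    rw [intervalIntegral.integral_comp_sub_left (fun y => h (k.castSucc.insertNth
      (α := fun _ => ℝ) (c - y) (k.insertNth (α := fun _ => ℝ) y r))), sub_self, sub_zero]
end

noncomputable section

/-! ### Stokes' theorem on a simplex -/

theorem fderiv_coord {E : Type*} [NormedAddCommGroup E] [NormedSpace ℝ E] {n : ℕ}
    {F : E → Fin n → ℝ} {s : E} (hF : DifferentiableAt ℝ F s) (v : E) (k : Fin n) :
    fderiv ℝ F s v k = fderiv ℝ (fun s => F s k) s v := by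
  rw [(hasFDerivAt_pi'.1 hF.hasFDerivAt k).fderiv]
  rfl

theorem fderiv_simplexFace_zero {n : ℕ} (s : Fin n → ℝ) (a : Fin n) :
    fderiv ℝ (simplexFace 0) s (Pi.single a 1) = Pi.single a.succ 1 - Pi.single 0 1 := by
  funext k
  rw [fderiv_coord ((contDiff_simplexFace 0).differentiable (by simp) s)]
  simp only [simplexFace_zero, bary]
  refine Fin.cases ?_ (fun k => ?_) k
  · simp only [Fin.cons_zero, Pi.sub_apply, Pi.single_eq_same]
    rw [fderiv_const_sub, fderiv_fun_sum fun i _ => by fun_prop]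
    simp [fderiv_apply, Pi.single_apply]
  · simp [fderiv_apply, Pi.single_apply]

theorem fderiv_simplexFace_succ {n : ℕ} (j : Fin (n + 1)) (s : Fin n → ℝ) (a : Fin n) :
    fderiv ℝ (simplexFace j.succ) s (Pi.single a 1) = Pi.single (j.succAbove a) 1 := by
  funext k
  rw [fderiv_coord ((contDiff_simplexFace _).differentiable (by simp) s)]
  simp only [simplexFace_succ]
  refine Fin.succAboveCases j ?_ (fun k => ?_) k
  · simp [Fin.ne_succAbove]
  · simp [fderiv_apply, Pi.single_apply]

/-- An alternating form on the edges of a simplex at a vertex, expanded in the standard basis. -/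
theorem AlternatingMap.map_single_succ_sub_single_zero {n : ℕ}
    (A : (Fin (n + 1) → ℝ) [⋀^Fin n]→ₗ[ℝ] ℝ) :
    A (fun a => Pi.single a.succ 1 - Pi.single 0 1) =
      ∑ i : Fin (n + 1), (-1) ^ (i : ℕ) * A (fun a => Pi.single (i.succAbove a) 1) := by
  -- The top-degree form `B = α ∧ A` is compared on two bases related by determinant `1`. As `α` is
  -- `1` on every basis vector and `0` on every edge `e_{a+1} - e_0`, evaluation on `v` leaves one
  -- term and evaluation on `e` gives the alternating sum.
  let α : (Fin (n + 1) → ℝ) →ₗ[ℝ] ℝ := ∑ i, LinearMap.proj i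
  let B := AlternatingMap.alternatizeUncurryFin (α.smulRight A)
  let v : Fin (n + 1) → Fin (n + 1) → ℝ :=
    Fin.cons (Pi.single 0 1) fun a : Fin n => Pi.single a.succ 1 - Pi.single 0 1
  let e : Fin (n + 1) → Fin (n + 1) → ℝ := fun k => Pi.single k 1
  have hdet : (Pi.basisFun ℝ (Fin (n + 1))).det v = 1 := by
    rw [Pi.basisFun_det]
    change Matrix.det (Matrix.of v) = 1
    rw [Matrix.det_of_isLowerTriangular]
    · refine Finset.prod_eq_one fun i _ => ?_
      refine Fin.cases ?_ (fun i => ?_) i <;> simp [v]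
    · intro i j hij
      rw [OrderDual.toDual_lt_toDual] at hij
      revert hij
      refine Fin.cases ?_ (fun i => ?_) i
      · intro hij
        simp [v, hij.ne']
      · intro hij
        have : (0 : Fin (n + 1)) < j := (Fin.succ_pos i).trans hij
        simp [v, hij.ne', this.ne']
  have hBe : B v = B e := by
    rw [B.eq_smul_basis_det (Pi.basisFun ℝ (Fin (n + 1)))]
    have he : ⇑(Pi.basisFun ℝ (Fin (n + 1))) = e := by
      funext k
      simp [e]
    have h1 : (Pi.basisFun ℝ (Fin (n + 1))).det e = 1 := by
      rw [← he]
      exact Module.Basis.det_self _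
    rw [AlternatingMap.smul_apply, AlternatingMap.smul_apply, hdet, h1]
  have hv : B v = A (fun a => Pi.single a.succ 1 - Pi.single 0 1) := by
    simp only [B, AlternatingMap.alternatizeUncurryFin_apply]
    rw [Fin.sum_univ_succ, Finset.sum_eq_zero]
    · have : Fin.removeNth 0 v = fun a : Fin n => Pi.single a.succ 1 - Pi.single 0 1 := by
        funext a
        simp [v, Fin.removeNth]
      rw [this]
      simp [v, α, Pi.single_apply]
    · intro i _
      simp [v, α, Pi.single_apply]
  have he : B e = ∑ i : Fin (n + 1), (-1) ^ (i : ℕ) * A (fun a => Pi.single (i.succAbove a) 1) := by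
    simp only [B, AlternatingMap.alternatizeUncurryFin_apply]
    refine Finset.sum_congr rfl fun i _ => ?_
    simp [e, α, Pi.single_apply]
    rfl
  rw [← hv, hBe, he]

/-- Stokes' theorem on the standard simplex. -/
theorem simplex_stokes {n : ℕ} (ψ : (Fin (n + 1) → ℝ) → (Fin (n + 1) → ℝ) [⋀^Fin n]→ₗ[ℝ] ℝ)
    (hψ : ∀ v, ContDiffOn ℝ 1 (fun t => ψ t v) (simplex (n + 1))) :
    ∑ i : Fin (n + 1), (-1) ^ (i : ℕ) * ∫ t in simplex (n + 1),
        fderivWithin ℝ (fun t => ψ t (fun a => Pi.single (i.succAbove a) 1)) (simplex (n + 1)) t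
          (Pi.single i 1) =
      ∑ j : Fin (n + 2), (-1) ^ (j : ℕ) * ∫ s in simplex n,
        ψ (simplexFace j s) (fun a => fderiv ℝ (simplexFace j) s (Pi.single a 1)) := by
  have hface : ∀ (j : Fin (n + 2)) (v), IntegrableOn (fun s => ψ (simplexFace j s) v)
      (simplex n) := fun j v =>
    ((hψ v).continuousOn.comp (contDiff_simplexFace j).continuous.continuousOn
      (mapsTo_simplexFace j)).integrableOn_compact (isCompact_simplex n)
  have hins : ∀ (i : Fin (n + 1)) (v), IntegrableOn
      (fun s => ψ (i.insertNth (α := fun _ => ℝ) (1 - ∑ a, s a) s) v) (simplex n) := fun i v => by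
    refine ((hψ v).continuousOn.comp (Continuous.continuousOn ?_) fun s hs =>
      (insertNth_mem_simplex_iff i _ s).2
        ⟨hs, by linarith [(mem_simplex_iff.1 hs).2], le_rfl⟩).integrableOn_compact
      (isCompact_simplex n)
    exact Continuous.finInsertNth i (by fun_prop) continuous_id
  rw [Fin.sum_univ_succ (n := n + 1)]
  -- The slanted face is the coface `0`; its tangent vectors are edge differences, and expanding
  -- them distributes its integral over the coordinates `i`.
  have h0 : ∫ s in simplex n, ψ (simplexFace 0 s)
      (fun a => fderiv ℝ (simplexFace 0) s (Pi.single a 1)) =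
      ∑ i : Fin (n + 1), (-1) ^ (i : ℕ) * ∫ s in simplex n,
        ψ (bary s) (fun a => Pi.single (i.succAbove a) 1) := by
    simp only [fderiv_simplexFace_zero, AlternatingMap.map_single_succ_sub_single_zero]
    rw [integral_finsetSum _ fun i _ => (hface 0 _).const_mul _]
    simp only [integral_const_mul, simplexFace_zero]
  rw [h0, Fin.val_zero, pow_zero, one_mul, ← Finset.sum_add_distrib]
  refine Finset.sum_congr rfl fun i _ => ?_
  simp only [fderiv_simplexFace_succ]
  rw [setIntegral_simplex_fderivWithin i (hψ _), integral_sub (hins i _)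
    (by simpa only [simplexFace_succ, IntegrableOn] using hface i.succ _),
    setIntegral_simplex_insertNth i (hψ _).continuousOn]
  -- Coordinate `i` is the barycentric coordinate `i + 1`; the extra sign of the face `i.succ` is
  -- the minus sign at the lower end of the segment.
  simp only [simplexFace_succ, Fin.val_succ, pow_succ]
  ring
end

noncomputable section

/-! ### Contraction with the standard basis -/

section Contraction

variable {V W : Type*} [NormedAddCommGroup V] [NormedSpace ℝ V] [NormedAddCommGroup W]
  [NormedSpace ℝ W] {n l p : ℕ}

/-- The vectors `(v₁, 0), …, (v_n, 0), (0, w₁), …, (0, w_l)`. -/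
def blockVec {V W : Type*} [Zero V] [Zero W] (h : n + l = p) (v : Fin n → V) (w : Fin l → W) :
    Fin p → V × W := fun i =>
  Fin.append (fun a => ((v a, 0) : V × W)) (fun b => (0, w b)) (Fin.cast h.symm i)

omit [NormedSpace ℝ V] [NormedSpace ℝ W] in
theorem blockVec_castAdd (h : n + l = p) (v : Fin n → V) (w : Fin l → W) (a : Fin n) :
    blockVec h v w (Fin.cast h (Fin.castAdd l a)) = (v a, 0) := by
  simp [blockVec]

omit [NormedSpace ℝ V] [NormedSpace ℝ W] in
theorem blockVec_natAdd (h : n + l = p) (v : Fin n → V) (w : Fin l → W) (b : Fin l) :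
    blockVec h v w (Fin.cast h (Fin.natAdd n b)) = (0, w b) := by
  simp [blockVec]

theorem blockVec_ext {α : Type*} (h : n + l = p) {f g : Fin p → α}
    (h1 : ∀ a : Fin n, f (Fin.cast h (Fin.castAdd l a)) = g (Fin.cast h (Fin.castAdd l a)))
    (h2 : ∀ b : Fin l, f (Fin.cast h (Fin.natAdd n b)) = g (Fin.cast h (Fin.natAdd n b))) :
    f = g := by
  subst h
  funext i
  exact Fin.addCases h1 h2 i

omit [NormedSpace ℝ V] [NormedSpace ℝ W] in
theorem blockVec_update (h : n + l = p) [DecidableEq (Fin n)] (v : Fin n → V) (w : Fin l → W)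
    (a : Fin n) (x : V) :
    blockVec h (Function.update v a x) w =
      Function.update (blockVec h v w) (Fin.cast h (Fin.castAdd l a)) (x, 0) := by
  refine blockVec_ext h (fun c => ?_) (fun c => ?_)
  · rw [blockVec_castAdd]
    by_cases hc : c = a
    · subst hc
      simp
    · rw [Function.update_of_ne hc, Function.update_of_ne, blockVec_castAdd]
      simpa [Fin.ext_iff] using hc
  · rw [blockVec_natAdd, Function.update_of_ne, blockVec_natAdd]
    simp only [ne_eq, Fin.ext_iff, Fin.val_cast, Fin.val_natAdd, Fin.val_castAdd]
    omega

/-- Plugging in fixed horizontal vectors in the last arguments of an alternating form on a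
product. -/
def sliceVertical (h : n + l = p) (θ : (V × W) [⋀^Fin p]→L[ℝ] ℝ) (w : Fin l → W) :
    V [⋀^Fin n]→ₗ[ℝ] ℝ where
  toFun v := θ (blockVec h v w)
  map_update_add' v a x y := by
    have e : ((x + y, 0) : V × W) = (x, 0) + (y, 0) := by simp
    simp only [blockVec_update, e, θ.map_update_add]
  map_update_smul' v a c x := by
    have e : ((c • x, 0) : V × W) = c • (x, 0) := by simp
    simp only [blockVec_update, e, θ.map_update_smul]
  map_eq_zero_of_eq' v a c hv hac := by
    refine θ.map_eq_zero_of_eq _ (i := Fin.cast h (Fin.castAdd l a))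
      (j := Fin.cast h (Fin.castAdd l c)) ?_ ?_
    · rw [blockVec_castAdd, blockVec_castAdd, hv]
    · simpa [Fin.ext_iff] using hac

theorem sliceVertical_apply (h : n + l = p) (θ : (V × W) [⋀^Fin p]→L[ℝ] ℝ) (w : Fin l → W)
    (v : Fin n → V) : sliceVertical h θ w v = θ (blockVec h v w) := rfl

theorem contractVertical_apply (h : n + l = p) (θ : ((Fin n → ℝ) × W) [⋀^Fin p]→L[ℝ] ℝ)
    (w : Fin l → W) : contractVertical h θ w = θ (blockVec h (fun a => Pi.single a 1) w) := rfl

theorem prodMap_comp_blockVec {V' W' : Type*} [NormedAddCommGroup V'] [NormedSpace ℝ V']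
    [NormedAddCommGroup W'] [NormedSpace ℝ W'] (h : n + l = p) (L : V →L[ℝ] V') (R : W →L[ℝ] W')
    (v : Fin n → V) (w : Fin l → W) :
    L.prodMap R ∘ blockVec h v w = blockVec h (L ∘ v) (R ∘ w) := by
  refine blockVec_ext h (fun c => ?_) (fun c => ?_)
  · simp [blockVec_castAdd]
  · simp [blockVec_natAdd]

/-- Contracting the pullback by a product map. -/
theorem contractVertical_comp_prodMap {W' : Type*} [NormedAddCommGroup W'] [NormedSpace ℝ W']
    {m : ℕ} (h : n + l = p) (θ : ((Fin m → ℝ) × W') [⋀^Fin p]→L[ℝ] ℝ)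
    (L : (Fin n → ℝ) →L[ℝ] (Fin m → ℝ)) (R : W →L[ℝ] W') (w : Fin l → W) :
    contractVertical h (θ.compContinuousLinearMap (L.prodMap R)) w =
      sliceVertical h θ (R ∘ w) (fun a => L (Pi.single a 1)) := by
  rw [contractVertical_apply, sliceVertical_apply]
  exact congrArg θ (prodMap_comp_blockVec h L R _ w)

theorem contractVertical_comp_id_prodMap {W' : Type*} [NormedAddCommGroup W'] [NormedSpace ℝ W']
    (h : n + l = p) (θ : ((Fin n → ℝ) × W') [⋀^Fin p]→L[ℝ] ℝ) (R : W →L[ℝ] W') :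
    contractVertical h (θ.compContinuousLinearMap ((ContinuousLinearMap.id ℝ _).prodMap R)) =
      (contractVertical h θ).compContinuousLinearMap R := by
  ext w
  exact contractVertical_comp_prodMap h θ (ContinuousLinearMap.id ℝ _) R w

/-- Contracting with too many vectors gives zero. -/
theorem contractVertical_comp_prodMap_eq_zero {W' : Type*} [NormedAddCommGroup W']
    [NormedSpace ℝ W'] {m : ℕ} (hm : m < n) (h : n + l = p)
    (θ : ((Fin m → ℝ) × W') [⋀^Fin p]→L[ℝ] ℝ)
    (L : (Fin n → ℝ) →L[ℝ] (Fin m → ℝ)) (R : W →L[ℝ] W') :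
    contractVertical h (θ.compContinuousLinearMap (L.prodMap R)) = 0 := by
  ext w
  rw [contractVertical_comp_prodMap]
  -- The `n` vectors `L (e_a)` lie in `ℝᵐ` with `m < n`, so they are linearly dependent.
  refine AlternatingMap.map_linearDependent _ _ fun hli => ?_
  have := hli.fintype_card_le_finrank
  simp at this
  omega

/-- `contractVertical` as a continuous linear map. -/
def contractVerticalCLM (W : Type*) [NormedAddCommGroup W] [NormedSpace ℝ W] {n l p : ℕ}
    (h : n + l = p) :
    (((Fin n → ℝ) × W) [⋀^Fin p]→L[ℝ] ℝ) →L[ℝ] (W [⋀^Fin l]→L[ℝ] ℝ) :=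
  LinearMap.mkContinuous
    { toFun := contractVertical h
      map_add' := fun _ _ => rfl
      map_smul' := fun _ _ => rfl } 1 fun θ => by
    refine ContinuousAlternatingMap.opNorm_le_bound _ (by positivity) fun w => ?_
    rw [one_mul]
    refine (θ.le_opNorm (blockVec h (fun a => Pi.single a 1) w)).trans
      (mul_le_mul_of_nonneg_left ?_ (norm_nonneg θ))
    subst h
    rw [Fin.prod_univ_add]
    -- The standard basis vectors have sup norm `1`, so contraction with them does not increase the
    -- norm; hence the bound `1`.
    have h1 : ∀ a : Fin n, ‖blockVec (rfl : n + l = n + l)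
        (fun a => (Pi.single a 1 : Fin n → ℝ)) w (Fin.castAdd l a)‖ ≤ 1 := fun a => by
      have := blockVec_castAdd (rfl : n + l = n + l) (fun a => (Pi.single a 1 : Fin n → ℝ)) w a
      rw [Fin.cast_eq_self] at this
      rw [this]
      simp [Prod.norm_def, Pi.norm_single]
    have h2 : ∀ b : Fin l, ‖blockVec (rfl : n + l = n + l)
        (fun a => (Pi.single a 1 : Fin n → ℝ)) w (Fin.natAdd n b)‖ = ‖w b‖ := fun b => by
      have := blockVec_natAdd (rfl : n + l = n + l) (fun a => (Pi.single a 1 : Fin n → ℝ)) w b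
      rw [Fin.cast_eq_self] at this
      rw [this]
      simp [Prod.norm_def]
    simp only [h2]
    exact mul_le_of_le_one_left (Finset.prod_nonneg fun _ _ => norm_nonneg _)
      (Finset.prod_le_one (fun _ _ => norm_nonneg _) fun a _ => h1 a)

omit [NormedSpace ℝ V] [NormedSpace ℝ W] in
theorem removeNth_blockVec_castAdd (h : n + 1 + l = p + 1) (h' : n + l = p) (v : Fin (n + 1) → V)
    (w : Fin l → W) (a : Fin (n + 1)) :
    (Fin.cast h (Fin.castAdd l a)).removeNth (blockVec h v w) =
      blockVec h' (fun c => v (a.succAbove c)) w := by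
  refine blockVec_ext h' (fun c => ?_) (fun c => ?_)
  · have : (Fin.cast h (Fin.castAdd l a)).succAbove (Fin.cast h' (Fin.castAdd l c)) =
        Fin.cast h (Fin.castAdd l (a.succAbove c)) := by
      ext
      simp only [Fin.succAbove, Fin.lt_def, Fin.val_castSucc, Fin.val_cast, Fin.val_castAdd]
      split_ifs <;> simp
    rw [blockVec_castAdd, Fin.removeNth, this, blockVec_castAdd]
  · have : (Fin.cast h (Fin.castAdd l a)).succAbove (Fin.cast h' (Fin.natAdd n c)) =
        Fin.cast h (Fin.natAdd (n + 1) c) := by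
      ext
      simp only [Fin.succAbove, Fin.lt_def, Fin.val_castSucc, Fin.val_cast, Fin.val_castAdd,
        Fin.val_natAdd]
      split_ifs <;> simp <;> omega
    rw [blockVec_natAdd, Fin.removeNth, this, blockVec_natAdd]

omit [NormedSpace ℝ V] [NormedSpace ℝ W] in
theorem removeNth_blockVec_natAdd (h : n + (l + 1) = p + 1) (h' : n + l = p) (v : Fin n → V)
    (w : Fin (l + 1) → W) (b : Fin (l + 1)) :
    (Fin.cast h (Fin.natAdd n b)).removeNth (blockVec h v w) =
      blockVec h' v (b.removeNth w) := by
  refine blockVec_ext h' (fun c => ?_) (fun c => ?_)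
  · have : (Fin.cast h (Fin.natAdd n b)).succAbove (Fin.cast h' (Fin.castAdd l c)) =
        Fin.cast h (Fin.castAdd (l + 1) c) := by
      ext
      simp only [Fin.succAbove, Fin.lt_def, Fin.val_castSucc, Fin.val_cast, Fin.val_castAdd,
        Fin.val_natAdd]
      split_ifs <;> simp <;> omega
    rw [blockVec_castAdd, Fin.removeNth, this, blockVec_castAdd]
  · have : (Fin.cast h (Fin.natAdd n b)).succAbove (Fin.cast h' (Fin.natAdd n c)) =
        Fin.cast h (Fin.natAdd n (b.succAbove c)) := by
      ext
      simp only [Fin.succAbove, Fin.lt_def, Fin.val_castSucc, Fin.val_cast, Fin.val_natAdd]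
      split_ifs <;> simp <;> omega
    rw [blockVec_natAdd, Fin.removeNth, this, blockVec_natAdd, Fin.removeNth]

/-- The vector `w b` stands in position `n + b`, which produces the common factor `(-1)^n` of the
horizontal terms. -/
theorem alternatizeUncurryFin_blockVec (h : n + l = p + 1)
    (f : (V × W) →L[ℝ] (V × W) [⋀^Fin p]→L[ℝ] ℝ) (v : Fin n → V) (w : Fin l → W) :
    ContinuousAlternatingMap.alternatizeUncurryFin f (blockVec h v w) =
      (∑ a : Fin n, (-1) ^ (a : ℕ) *
        f (v a, 0) ((Fin.cast h (Fin.castAdd l a)).removeNth (blockVec h v w))) +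
      (-1) ^ n * ∑ b : Fin l, (-1) ^ (b : ℕ) *
        f (0, w b) ((Fin.cast h (Fin.natAdd n b)).removeNth (blockVec h v w)) := by
  rw [ContinuousAlternatingMap.alternatizeUncurryFin_apply, ← (finCongr h).sum_comp,
    Fin.sum_univ_add, Finset.mul_sum]
  refine congrArg₂ (· + ·) (Finset.sum_congr rfl fun a _ => ?_) (Finset.sum_congr rfl fun b _ => ?_)
  · rw [finCongr_apply, blockVec_castAdd]
    simp
  · rw [finCongr_apply, blockVec_natAdd]
    simp [pow_add, mul_assoc]

end Contraction
end

noncomputable section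

/-! ### Integrating the exterior derivative in coordinates -/

section FiberStokes

variable {W : Type} [NormedAddCommGroup W] [NormedSpace ℝ W] [ProperSpace W] {n l p : ℕ}
  {U : Set W} {g : (Fin n → ℝ) × W → ((Fin n → ℝ) × W) [⋀^Fin p]→L[ℝ] ℝ}

omit [ProperSpace W] in
theorem integrableOn_contractVertical (h : n + l = p) (hg : ContinuousOn g (simplex n ×ˢ U))
    {y : W} (hy : y ∈ U) :
    IntegrableOn (fun t => contractVertical h (g (t, y))) (simplex n) := by
  have : ContinuousOn (fun q => contractVerticalCLM W h (g q)) (simplex n ×ˢ U) :=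
    (contractVerticalCLM W h).continuous.comp_continuousOn hg
  exact integrableOn_slice (isCompact_simplex n) this hy

theorem contDiffOn_integral_contractVertical (h : n + l = p) (hU : IsOpen U)
    (hg : ContDiffOn ℝ ∞ g (simplex n ×ˢ U)) :
    ContDiffOn ℝ ∞ (fun y => ∫ t in simplex n, contractVertical h (g (t, y))) U :=
  contDiffOn_setIntegral (g := fun q => contractVerticalCLM W h (g q)) (isCompact_simplex n)
    (uniqueDiffOn_simplex n) hU ((contractVerticalCLM W h).contDiff.comp_contDiffOn hg)

theorem integral_alternating_apply {α F : Type*} [MeasurableSpace α] {μ : Measure α}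
    [NormedAddCommGroup F] [NormedSpace ℝ F] {f : α → F [⋀^Fin l]→L[ℝ] ℝ} (hf : Integrable f μ)
    (w : Fin l → F) : (∫ t, f t ∂μ) w = ∫ t, f t w ∂μ :=
  ((ContinuousAlternatingMap.apply ℝ F ℝ w).integral_comp_comm hf).symm

/-- The horizontal part of the exterior derivative integrates to the exterior derivative of the
integral. -/
theorem extDerivWithin_integral_contractVertical (h : n + l = p) (hU : IsOpen U)
    (hg : ContDiffOn ℝ ∞ g (simplex n ×ˢ U)) {y : W} (hy : y ∈ U) (w : Fin (l + 1) → W) :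
    extDerivWithin (fun y => ∫ t in simplex n, contractVertical h (g (t, y))) U y w =
      ∫ t in simplex n, ∑ b : Fin (l + 1), (-1) ^ (b : ℕ) *
        fderivWithin ℝ g (simplex n ×ˢ U) (t, y) (0, w b)
          (blockVec h (fun a => Pi.single a 1) (b.removeNth w)) := by
  have hu : UniqueDiffOn ℝ (simplex n ×ˢ U) := (uniqueDiffOn_simplex n).prod hU.uniqueDiffOn
  have hg1 : ContDiffOn ℝ 1 (fun q => contractVerticalCLM W h (g q)) (simplex n ×ˢ U) :=
    ((contractVerticalCLM W h).contDiff.comp_contDiffOn hg).of_le (by simp)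
  have hfd : ContinuousOn (fderivWithin ℝ g (simplex n ×ˢ U)) (simplex n ×ˢ U) :=
    hg.continuousOn_fderivWithin hu (by simp)
  unfold extDerivWithin
  rw [ContinuousAlternatingMap.alternatizeUncurryFin_apply]
  have hterm : ∀ b : Fin (l + 1), IntegrableOn (fun t => (-1) ^ (b : ℕ) *
        fderivWithin ℝ g (simplex n ×ˢ U) (t, y) (0, w b)
          (blockVec h (fun a => Pi.single a 1) (b.removeNth w))) (simplex n) := fun b => by
    have hc' : ContinuousOn (fun q => (-1) ^ (b : ℕ) *
        fderivWithin ℝ g (simplex n ×ˢ U) q (0, w b)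
          (blockVec h (fun a => Pi.single a 1) (b.removeNth w))) (simplex n ×ˢ U) :=
      continuousOn_const.mul ((ContinuousAlternatingMap.apply ℝ _ ℝ _).continuous.comp_continuousOn
        (hfd.clm_apply continuousOn_const))
    exact integrableOn_slice (isCompact_simplex n) hc' hy
  rw [integral_finsetSum _ fun b _ => hterm b, fderivWithin_of_isOpen hU hy]
  refine Finset.sum_congr rfl fun b _ => ?_
  rw [integral_const_mul, zsmul_eq_mul]
  push_cast
  congr 1
  -- Evaluation at fixed vectors is a continuous linear functional, so it passes through both the
  -- derivative and the integral.
  refine (clm_fderiv_setIntegral_apply (μ := volume) (isCompact_simplex n) (uniqueDiffOn_simplex n)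
    hU hg1 hy (w b) (ContinuousAlternatingMap.apply ℝ W ℝ (b.removeNth w))).trans ?_
  refine setIntegral_congr_fun (isClosed_simplex n).measurableSet fun t ht => ?_
  have hgd : DifferentiableWithinAt ℝ g (simplex n ×ˢ U) (t, y) :=
    hg.differentiableOn (by simp) _ ⟨ht, hy⟩
  have : fderivWithin ℝ (fun q => contractVerticalCLM W h (g q)) (simplex n ×ˢ U) (t, y) =
      (contractVerticalCLM W h).comp (fderivWithin ℝ g (simplex n ×ˢ U) (t, y)) :=
    ((contractVerticalCLM W h).hasFDerivAt.comp_hasFDerivWithinAt _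
      hgd.hasFDerivWithinAt).fderivWithin (hu _ ⟨ht, hy⟩)
  rw [this]
  rfl

omit [ProperSpace W] in
theorem fderivWithin_slice_vertical (hg : ContDiffOn ℝ ∞ g (simplex n ×ˢ U))
    {y : W} (hy : y ∈ U) {t : Fin n → ℝ} (ht : t ∈ simplex n) (v : Fin n → ℝ)
    (u : Fin p → (Fin n → ℝ) × W) :
    fderivWithin ℝ (fun t => g (t, y) u) (simplex n) t v =
      fderivWithin ℝ g (simplex n ×ˢ U) (t, y) (v, 0) u := by
  have hgd := (hg.differentiableOn (by simp) (t, y) ⟨ht, hy⟩).hasFDerivWithinAt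
  have h1 : HasFDerivWithinAt (fun t : Fin n → ℝ => (t, y))
      (ContinuousLinearMap.inl ℝ (Fin n → ℝ) W) (simplex n) t :=
    (hasFDerivAt_prodMk_left t y).hasFDerivWithinAt
  have hm : MapsTo (fun t => (t, y)) (simplex n) (simplex n ×ˢ U) := fun t ht => ⟨ht, hy⟩
  have h2 := hgd.comp t h1 hm
  have h3 := (ContinuousAlternatingMap.apply ℝ ((Fin n → ℝ) × W) ℝ
    u).hasFDerivAt.comp_hasFDerivWithinAt t h2
  have h4 : HasFDerivWithinAt (fun t => g (t, y) u) _ (simplex n) t := h3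
  rw [h4.fderivWithin (uniqueDiffOn_simplex n t ht)]
  rfl

end FiberStokes

variable {W : Type} [NormedAddCommGroup W] [NormedSpace ℝ W] [ProperSpace W] {n l p : ℕ}
  {U : Set W}

omit [ProperSpace W] in
/-- The vertical part of the exterior derivative integrates to the integrals over the faces. -/
theorem integral_vertical_extDerivWithin
    {g : (Fin (n + 1) → ℝ) × W → ((Fin (n + 1) → ℝ) × W) [⋀^Fin p]→L[ℝ] ℝ}
    (h : n + l = p) (hg : ContDiffOn ℝ ∞ g (simplex (n + 1) ×ˢ U)) {y : W}
    (hy : y ∈ U) (w : Fin l → W) :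
    ∫ t in simplex (n + 1), ∑ a : Fin (n + 1), (-1) ^ (a : ℕ) *
        fderivWithin ℝ g (simplex (n + 1) ×ˢ U) (t, y) (Pi.single a 1, 0)
          (blockVec h (fun c => Pi.single (a.succAbove c) 1) w) =
      ∑ j : Fin (n + 2), (-1) ^ (j : ℕ) * ∫ s in simplex n,
        contractVertical h ((g (simplexFace j s, y)).compContinuousLinearMap
          ((fderiv ℝ (simplexFace j) s).prodMap (ContinuousLinearMap.id ℝ W))) w := by
  have hslice : ∀ v, ContDiffOn ℝ 1 (fun t => sliceVertical h (g (t, y)) w v) (simplex (n + 1)) := by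
    intro v
    have h1 : ContDiffOn ℝ ∞ (fun t => g (t, y)) (simplex (n + 1)) :=
      hg.comp (by fun_prop) fun t ht => ⟨ht, hy⟩
    exact ((ContinuousAlternatingMap.apply ℝ ((Fin (n + 1) → ℝ) × W) ℝ
      (blockVec h v w)).contDiff.comp_contDiffOn h1).of_le (by simp)
  -- With `y` and `w` frozen, the remaining arguments give an ordinary `n`-form on the simplex of
  -- dimension `n + 1`.
  have key := simplex_stokes (fun t => sliceVertical h (g (t, y)) w) hslice
  simp only [contractVertical_comp_prodMap]
  refine Eq.trans ?_ key
  rw [integral_finsetSum]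
  · refine Finset.sum_congr rfl fun a _ => ?_
    rw [integral_const_mul]
    congr 1
    refine setIntegral_congr_fun (isClosed_simplex _).measurableSet fun t ht => ?_
    exact (fderivWithin_slice_vertical hg hy ht _ _).symm
  · intro a _
    refine Integrable.const_mul ?_ _
    have hc := ((hslice fun c => Pi.single (a.succAbove c) 1).continuousOn_fderivWithin
      (uniqueDiffOn_simplex _) (by simp)).clm_apply
      (continuousOn_const (c := (Pi.single a 1 : Fin (n + 1) → ℝ)))
    refine (hc.congr fun t ht => ?_).integrableOn_compact (isCompact_simplex _)
    exact (fderivWithin_slice_vertical hg hy ht _ _).symm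
end

noncomputable section

/-! ### Forms on products -/

section

variable {E : Type*} [NormedAddCommGroup E] [NormedSpace ℝ E]
  {H : Type*} [TopologicalSpace H] {I : ModelWithCorners ℝ E H}
  {E' : Type*} [NormedAddCommGroup E'] [NormedSpace ℝ E']
  {H' : Type*} [TopologicalSpace H'] {I' : ModelWithCorners ℝ E' H'}
  {X : Type*} [TopologicalSpace X] [ChartedSpace H X]
  {Y : Type*} [TopologicalSpace Y] [ChartedSpace H' Y] {k : ℕ}

theorem modelDeriv_prodMap {V V' : Type*} [NormedAddCommGroup V] [NormedSpace ℝ V]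
    [NormedAddCommGroup V'] [NormedSpace ℝ V'] {f : V → V'} {g : X → Y} {q : V × X}
    (hf : DifferentiableAt ℝ f q.1) (hg : MDifferentiableAt I I' g q.2) :
    modelDeriv (𝓘(ℝ, V).prod I) (𝓘(ℝ, V').prod I') (Prod.map f g) q =
      (fderiv ℝ f q.1).prodMap (modelDeriv I I' g q.2) := by
  rw [← modelDeriv_eq_fderiv]
  exact mfderiv_prodMap hf.mdifferentiableAt hg

theorem RawForm.inChart_self [IsManifold I ∞ X] (θ : RawForm I X k) (x : X) :
    θ.inChart x (extChartAt I x x) = θ.val x := by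
  have : IsManifold I 1 X := IsManifold.of_le (n := ∞) (by norm_num)
  have h1 : θ.inChart x (extChartAt I x x) =
      (θ.val ((extChartAt I x).symm (extChartAt I x x))).compContinuousLinearMap
        (mfderivWithin 𝓘(ℝ, E) I (extChartAt I x).symm (range I) (extChartAt I x x) : E →L[ℝ] E) :=
    rfl
  have h2 : (mfderivWithin 𝓘(ℝ, E) I (extChartAt I x).symm (range I) (extChartAt I x x) :
      E →L[ℝ] E) = ContinuousLinearMap.id ℝ E := mfderivWithin_range_extChartAt_symm
  rw [h1, h2, extChartAt_to_inv]
  rfl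

/-- The expression in a product chart, on the product of a vector space and a manifold. -/
theorem RawForm.inChart_prod [I.Boundaryless] [IsManifold I ∞ X] {V : Type*} [NormedAddCommGroup V]
    [NormedSpace ℝ V] (θ : RawForm (𝓘(ℝ, V).prod I) (V × X) k) (q : V × X) {x₀ : X} (hq : q.2 = x₀)
    (t : V) {y : E} (hy : y ∈ (extChartAt I x₀).target) :
    θ.inChart q (t, y) = (θ.val (t, (extChartAt I x₀).symm y)).compContinuousLinearMap
      ((ContinuousLinearMap.id ℝ V).prodMap
        (modelDeriv 𝓘(ℝ, E) I (extChartAt I x₀).symm y)) := by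
  subst hq
  rw [RawForm.inChart_eq]
  have h1 : modelDeriv 𝓘(ℝ, V × E) (𝓘(ℝ, V).prod I) (extChartAt (𝓘(ℝ, V).prod I) q).symm (t, y) =
      (ContinuousLinearMap.id ℝ V).prodMap (modelDeriv 𝓘(ℝ, E) I (extChartAt I q.2).symm y) := by
    have h2 := modelDeriv_prodMap (I := 𝓘(ℝ, E)) (I' := I) (f := (id : V → V))
      (g := (extChartAt I q.2).symm) (q := (t, y)) differentiableAt_id
      (mdifferentiableAt_extChartAt_symm hy)
    rw [fderiv_id] at h2
    rw [← h2, modelWithCornersSelf_prod, ← chartedSpaceSelf_prod]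
    rfl
  rw [h1]
  rfl
end

variable {M : SimplicialObject SmoothMfd.{u}}

end

noncomputable section

/-! ### The fibre integral -/

variable {M : SimplicialObject SmoothMfd.{u}}

/-- The chart of `ℝⁿ` is the identity at every point, so the chart at `(0, x)` covers the whole
simplex; the base point `0` is an arbitrary choice. -/
theorem RawForm.SmoothOn.contDiffOn_inChart {n m p : ℕ}
    {φ : RawForm (prodModel M n m) ((Fin n → ℝ) × level M m) p}
    (hφ : φ.SmoothOn (simplexProd M n m)) (x : level M m) :
    ContDiffOn ℝ ∞ (φ.inChart (0, x))
      (simplex n ×ˢ (extChartAt (𝓡 (level M m).dim) x).target) := by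
  have := hφ (0, x)
  rwa [chartDomain_simplexProd] at this

theorem RawForm.inChart_zero_self {n m p : ℕ}
    (φ : RawForm (prodModel M n m) ((Fin n → ℝ) × level M m) p) (t : Fin n → ℝ) (x : level M m) :
    φ.inChart (0, x) (t, extChartAt (𝓡 (level M m).dim) x x) = φ.val (t, x) :=
  RawForm.inChart_self φ (t, x)

theorem RawForm.SmoothOn.integrableOn_contractVertical {n l p : ℕ} (h : n + l = p)
    {φ : RawForm (prodModel M n n) ((Fin n → ℝ) × level M n) p}
    (hφ : φ.SmoothOn (simplexProd M n n)) (x : level M n) :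
    IntegrableOn (fun t => contractVertical h (φ.val (t, x))) (simplex n) := by
  have := _root_.integrableOn_contractVertical h (hφ.contDiffOn_inChart x).continuousOn
    (mem_extChartAt_target x)
  simpa only [RawForm.inChart_zero_self] using this

theorem val_fiberIntegral {n l p : ℕ} (h : n + l = p)
    (φ : RawForm (prodModel M n n) ((Fin n → ℝ) × level M n) p) (x : level M n) :
    (fiberIntegral h φ).val x = ∫ t in simplex n, contractVertical h (φ.val (t, x)) := rfl

theorem integral_compContinuousLinearMap {α F F' : Type*} [MeasurableSpace α] {μ : Measure α}
    [NormedAddCommGroup F] [NormedSpace ℝ F] [NormedAddCommGroup F'] [NormedSpace ℝ F'] {l : ℕ}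
    {f : α → F [⋀^Fin l]→L[ℝ] ℝ} (hf : Integrable f μ) (A : F' →L[ℝ] F) :
    ∫ t, (f t).compContinuousLinearMap A ∂μ = (∫ t, f t ∂μ).compContinuousLinearMap A :=
  (ContinuousAlternatingMap.compContinuousLinearMapCLM A).integral_comp_comm hf

theorem integrable_compContinuousLinearMap {α F F' : Type*} [MeasurableSpace α] {μ : Measure α}
    [NormedAddCommGroup F] [NormedSpace ℝ F] [NormedAddCommGroup F'] [NormedSpace ℝ F'] {l : ℕ}
    {f : α → F [⋀^Fin l]→L[ℝ] ℝ} (hf : Integrable f μ) (A : F' →L[ℝ] F) :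
    Integrable (fun t => (f t).compContinuousLinearMap A) μ :=
  (ContinuousAlternatingMap.compContinuousLinearMapCLM A :
    (F [⋀^Fin l]→L[ℝ] ℝ) →L[ℝ] (F' [⋀^Fin l]→L[ℝ] ℝ)).integrable_comp hf

theorem contractVertical_pullback_id_prodMap {n m l p : ℕ} (h : n + l = p)
    (φ : RawForm (prodModel M n n) ((Fin n → ℝ) × level M n) p) (f : level M m ⟶ level M n)
    (t : Fin n → ℝ) (x : level M m) :
    contractVertical h ((RawForm.pullback (prodModel M n m) (Prod.map id f.toFun) φ).val (t, x)) =
      (contractVertical h (φ.val (t, f.toFun x))).compContinuousLinearMap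
        (modelDeriv (𝓡 (level M m).dim) (𝓡 (level M n).dim) f.toFun x) := by
  rw [← contractVertical_comp_id_prodMap, RawForm.val_pullback,
    modelDeriv_prodMap (I := 𝓡 (level M m).dim) (I' := 𝓡 (level M n).dim) (f := id)
      differentiableAt_id ((f.smooth x).mdifferentiableAt (by simp)), fderiv_id]
  rfl

theorem val_pullback_fiberIntegral {n m l p : ℕ} (h : n + l = p)
    {φ : RawForm (prodModel M n n) ((Fin n → ℝ) × level M n) p}
    (hφ : φ.SmoothOn (simplexProd M n n)) (f : level M m ⟶ level M n) (x : level M m) :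
    (RawForm.pullback (𝓡 (level M m).dim) f.toFun (fiberIntegral h φ)).val x =
      ∫ t in simplex n, contractVertical h
        ((RawForm.pullback (prodModel M n m) (Prod.map id f.toFun) φ).val (t, x)) := by
  rw [RawForm.val_pullback, val_fiberIntegral,
    ← integral_compContinuousLinearMap (hφ.integrableOn_contractVertical h _)]
  congr 1
  funext t
  exact (contractVertical_pullback_id_prodMap h φ f t x).symm

/-- A product chart is the identity in the simplex directions, so passing to coordinates commutes
with contraction, and being linear it commutes with the integral. Smoothness of the fibre integral
and its derivative thereby reduce to parametric integrals over an open set of a vector space. -/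
theorem inChart_fiberIntegral {n l p : ℕ} (h : n + l = p)
    {φ : RawForm (prodModel M n n) ((Fin n → ℝ) × level M n) p}
    (hφ : φ.SmoothOn (simplexProd M n n)) (x : level M n)
    {y : EuclideanSpace ℝ (Fin (level M n).dim)}
    (hy : y ∈ (extChartAt (𝓡 (level M n).dim) x).target) :
    (fiberIntegral h φ).inChart x y =
      ∫ t in simplex n, contractVertical h (φ.inChart (0, x) (t, y)) := by
  rw [RawForm.inChart_eq, val_fiberIntegral,
    ← integral_compContinuousLinearMap (hφ.integrableOn_contractVertical h _)]
  congr 1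
  funext t
  rw [RawForm.inChart_prod φ (0, x) rfl t hy, contractVertical_comp_id_prodMap]

theorem fiberIntegral_mem_smoothForms {n l p : ℕ} (h : n + l = p)
    {φ : RawForm (prodModel M n n) ((Fin n → ℝ) × level M n) p}
    (hφ : φ.SmoothOn (simplexProd M n n)) :
    fiberIntegral h φ ∈ smoothForms (𝓡 (level M n).dim) univ l := by
  refine ⟨fun x => ?_, fun x hx => (hx (mem_univ x)).elim⟩
  rw [chartDomain_univ]
  exact (contDiffOn_integral_contractVertical h (isOpen_extChartAt_target x)
    (hφ.contDiffOn_inChart x)).congr fun y hy => inChart_fiberIntegral h hφ x hy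

theorem val_d_fiberIntegral {n l p : ℕ} (h : n + l = p)
    {φ : RawForm (prodModel M n n) ((Fin n → ℝ) × level M n) p}
    (hφ : φ.SmoothOn (simplexProd M n n)) (x : level M n)
    (w : Fin (l + 1) → EuclideanSpace ℝ (Fin (level M n).dim)) :
    (RawForm.d univ (fiberIntegral h φ)).val x w =
      ∫ t in simplex n, ∑ b : Fin (l + 1), (-1) ^ (b : ℕ) *
        fderivWithin ℝ (φ.inChart (0, x))
          (simplex n ×ˢ (extChartAt (𝓡 (level M n).dim) x).target)
          (t, extChartAt (𝓡 (level M n).dim) x x) (0, w b)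
          (blockVec h (fun a => Pi.single a 1) (b.removeNth w)) := by
  have hmem := mem_extChartAt_target (I := 𝓡 (level M n).dim) x
  rw [← RawForm.inChart_self, RawForm.inChart_d (regularDomain_univ _)
    (fiberIntegral_mem_smoothForms h hφ).1 (by rwa [chartDomain_univ]), chartDomain_univ,
    ← extDerivWithin_integral_contractVertical h (isOpen_extChartAt_target x)
      (hφ.contDiffOn_inChart x) hmem]
  congr 1
  exact extDerivWithin_congr' (fun y hy => inChart_fiberIntegral h hφ x hy) hmem

theorem val_fiberIntegral_d {n l p : ℕ} (h : n + l = p + 1)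
    {φ : RawForm (prodModel M n n) ((Fin n → ℝ) × level M n) p}
    (hφ : φ.SmoothOn (simplexProd M n n)) (x : level M n)
    (w : Fin l → EuclideanSpace ℝ (Fin (level M n).dim)) :
    (fiberIntegral h (RawForm.d (simplexProd M n n) φ)).val x w =
      (∫ t in simplex n, ∑ a : Fin n, (-1) ^ (a : ℕ) *
        fderivWithin ℝ (φ.inChart (0, x))
          (simplex n ×ˢ (extChartAt (𝓡 (level M n).dim) x).target)
          (t, extChartAt (𝓡 (level M n).dim) x x) (Pi.single a 1, 0)
          ((Fin.cast h (Fin.castAdd l a)).removeNth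
            (blockVec h (fun a => Pi.single a 1) w))) +
      (-1) ^ n * ∫ t in simplex n, ∑ b : Fin l, (-1) ^ (b : ℕ) *
        fderivWithin ℝ (φ.inChart (0, x))
          (simplex n ×ˢ (extChartAt (𝓡 (level M n).dim) x).target)
          (t, extChartAt (𝓡 (level M n).dim) x x) (0, w b)
          ((Fin.cast h (Fin.natAdd n b)).removeNth
            (blockVec h (fun a => Pi.single a 1) w)) := by
  have hreg := regularDomain_simplexProd (M := M) n n
  have hmem := mem_extChartAt_target (I := 𝓡 (level M n).dim) x
  have ho := isOpen_extChartAt_target (I := 𝓡 (level M n).dim) x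
  have hg := hφ.contDiffOn_inChart x
  have hfd := hg.continuousOn_fderivWithin
    ((uniqueDiffOn_simplex n).prod ho.uniqueDiffOn) (by simp)
  have hterm : ∀ (c : ℝ) (v : (Fin n → ℝ) × EuclideanSpace ℝ (Fin (level M n).dim)) (u),
      IntegrableOn (fun t => c * fderivWithin ℝ (φ.inChart (0, x))
        (simplex n ×ˢ (extChartAt (𝓡 (level M n).dim) x).target)
        (t, extChartAt (𝓡 (level M n).dim) x x) v u) (simplex n) := by
    intro c v u
    have hc : ContinuousOn (fun q => c * fderivWithin ℝ (φ.inChart (0, x))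
        (simplex n ×ˢ (extChartAt (𝓡 (level M n).dim) x).target) q v u)
        (simplex n ×ˢ (extChartAt (𝓡 (level M n).dim) x).target) :=
      continuousOn_const.mul ((ContinuousAlternatingMap.apply ℝ _ ℝ u).continuous.comp_continuousOn
        (hfd.clm_apply continuousOn_const))
    exact integrableOn_slice (isCompact_simplex n) hc hmem
  rw [val_fiberIntegral, integral_alternating_apply ((hφ.d hreg).integrableOn_contractVertical h x),
    ← integral_const_mul, ← integral_add (integrable_finsetSum _ fun a _ => hterm _ _ _)
      ((integrable_finsetSum _ fun b _ => hterm _ _ _).const_mul _)]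
  refine setIntegral_congr_fun (isClosed_simplex n).measurableSet fun t ht => ?_
  rw [← RawForm.inChart_zero_self, RawForm.inChart_d hreg hφ
    (by rw [chartDomain_simplexProd]; exact ⟨ht, hmem⟩), chartDomain_simplexProd,
    contractVertical_apply, extDerivWithin, alternatizeUncurryFin_blockVec h]

/-- Stokes' theorem produces the pullbacks of `φ (n + 1)` along the cofaces, and the first gluing
condition identifies them with pullbacks of `φ n` along the face maps of `M`. -/
theorem integral_vertical_eq_horDiff {p n l : ℕ} (h : n + l = p) {φ : RawFamily M p}
    (hφ : φ ∈ realizationForms M p) (x : level M (n + 1))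
    (w : Fin l → EuclideanSpace ℝ (Fin (level M (n + 1)).dim)) :
    ∫ t in simplex (n + 1), ∑ a : Fin (n + 1), (-1) ^ (a : ℕ) *
        fderivWithin ℝ ((φ (n + 1)).inChart (0, x))
          (simplex (n + 1) ×ˢ (extChartAt (𝓡 (level M (n + 1)).dim) x).target)
          (t, extChartAt (𝓡 (level M (n + 1)).dim) x x) (Pi.single a 1, 0)
          (blockVec h (fun c => Pi.single (a.succAbove c) 1) w) =
      (horDiff (fiberIntegral h (φ n))).val x w := by
  rw [integral_vertical_extDerivWithin h ((hφ.1 (n + 1)).1.contDiffOn_inChart x)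
    (mem_extChartAt_target x)]
  have hhor : (horDiff (fiberIntegral h (φ n))).val x =
      ∑ j : Fin (n + 2), (-1 : ℝ) ^ (j : ℕ) • (RawForm.pullback (𝓡 (level M (n + 1)).dim)
        (M.δ j).toFun (fiberIntegral h (φ n))).val x := by
    exact Finset.sum_apply x Finset.univ fun j : Fin (n + 2) => (-1 : ℝ) ^ (j : ℕ) •
      RawForm.pullback (𝓡 (level M (n + 1)).dim) (M.δ j).toFun (fiberIntegral h (φ n))
  rw [hhor, ContinuousAlternatingMap.sum_apply]
  refine Finset.sum_congr rfl fun j _ => ?_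
  have hpb := val_pullback_fiberIntegral h (hφ.1 n).1 (M.δ j : level M (n + 1) ⟶ level M n) x
  have heq : ∀ s ∈ simplex n, contractVertical h
      (((φ (n + 1)).inChart (0, x)
        (simplexFace j s, extChartAt (𝓡 (level M (n + 1)).dim) x x)).compContinuousLinearMap
          ((fderiv ℝ (simplexFace j) s).prodMap (ContinuousLinearMap.id ℝ _))) =
      contractVertical h ((RawForm.pullback (prodModel M n (n + 1))
        (Prod.map id (M.δ j).toFun) (φ n)).val (s, x)) := by
    intro s hs
    have h1 : (RawForm.pullback (prodModel M n (n + 1)) (Prod.map id (M.δ j).toFun)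
        (φ n)).val (s, x) = (RawForm.pullback (prodModel M n (n + 1))
          (Prod.map (simplexFace j) id) (φ (n + 1))).val (s, x) :=
      (hφ.2.1 n j (s, x) ⟨hs, mem_univ _⟩).symm
    rw [h1, RawForm.val_pullback, modelDeriv_prodMap (I := 𝓡 (level M (n + 1)).dim)
      (I' := 𝓡 (level M (n + 1)).dim) (f := simplexFace j) (g := id)
      ((contDiff_simplexFace j).differentiable (by simp) s) mdifferentiableAt_id,
      RawForm.inChart_zero_self]
    have h2 : modelDeriv (𝓡 (level M (n + 1)).dim) (𝓡 (level M (n + 1)).dim) id x =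
      ContinuousLinearMap.id ℝ _ := mfderiv_id
    rw [h2]
    rfl
  have hint : IntegrableOn (fun s => contractVertical h ((RawForm.pullback (prodModel M n (n + 1))
      (Prod.map id (M.δ j).toFun) (φ n)).val (s, x))) (simplex n) := by
    simp only [contractVertical_pullback_id_prodMap]
    exact integrable_compContinuousLinearMap ((hφ.1 n).1.integrableOn_contractVertical h _) _
  rw [hpb, ContinuousAlternatingMap.smul_apply, integral_alternating_apply hint, smul_eq_mul]
  congr 1
  exact setIntegral_congr_fun (isClosed_simplex n).measurableSet fun s hs =>
    congrArg (fun θ => θ w) (heq s hs)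
end

noncomputable section

/-! ### Integration along the simplices -/

variable {M : SimplicialObject SmoothMfd.{u}}

/-- By the second gluing condition the integrand is a contraction of `(η_i × id)^* φ_k`. It vanishes
pointwise, since `η_i` maps the `k + 1` coordinate directions into `ℝᵏ`. -/
theorem pullback_degeneracy_fiberIntegral {p k l : ℕ} (h : k + 1 + l = p) {φ : RawFamily M p}
    (hφ : φ ∈ realizationForms M p) (i : Fin (k + 1)) :
    RawForm.pullback (𝓡 (level M k).dim) (M.σ i).toFun (fiberIntegral h (φ (k + 1))) = 0 := by
  funext x
  refine (val_pullback_fiberIntegral h (hφ.1 (k + 1)).1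
    (M.σ i : level M k ⟶ level M (k + 1)) x).trans ?_
  refine (setIntegral_congr_fun (g := fun _ => 0) (isClosed_simplex (k + 1)).measurableSet
    fun t ht => ?_).trans (integral_zero _ _)
  have h1 : (RawForm.pullback (prodModel M (k + 1) k) (Prod.map id (M.σ i).toFun)
      (φ (k + 1))).val (t, x) = (RawForm.pullback (prodModel M (k + 1) k)
        (Prod.map (simplexDegen i) id) (φ k)).val (t, x) :=
    (hφ.2.2 k i (t, x) ⟨ht, mem_univ _⟩).symm
  dsimp only
  rw [h1, RawForm.val_pullback, modelDeriv_prodMap (I := 𝓡 (level M k).dim)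
    (I' := 𝓡 (level M k).dim) (f := simplexDegen i) (g := id)
    ((contDiff_simplexDegen i).differentiable (by simp) t) mdifferentiableAt_id]
  exact contractVertical_comp_prodMap_eq_zero (Nat.lt_succ_self k) h _ _ _

theorem RawFamily.integral_mem_Tot {p : ℕ} {φ : RawFamily M p}
    (hφ : φ ∈ realizationForms M p) : φ.integral ∈ Tot M p := by
  rintro ⟨⟨k, l⟩, h⟩
  have hs := fiberIntegral_mem_smoothForms h (hφ.1 k).1
  obtain _ | k := k
  · exact hs
  · exact ⟨hs, fun i => pullback_degeneracy_fiberIntegral h hφ i⟩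

variable (M) in
/-- Integration along the simplices, as a linear map to the normalized total complex. -/
def simplexIntegral (p : ℕ) : realizationForms M p →ₗ[ℝ] Tot M p where
  toFun φ := ⟨(φ : RawFamily M p).integral, RawFamily.integral_mem_Tot φ.2⟩
  map_add' φ ψ := by
    refine Subtype.ext (funext fun b => funext fun x => ?_)
    exact integral_add ((φ.2.1 b.1.1).1.integrableOn_contractVertical b.2 x)
      ((ψ.2.1 b.1.1).1.integrableOn_contractVertical b.2 x)
  map_smul' c φ := by
    refine Subtype.ext (funext fun b => funext fun x => ?_)
    exact integral_smul (G := EuclideanSpace ℝ (Fin (level M b.1.1).dim) [⋀^Fin b.1.2]→L[ℝ] ℝ) c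
      fun t => contractVertical b.2 ((φ.1 b.1.1).val (t, x))

/-- The vertical terms match `δ` and the horizontal ones `(-1)^k d`. For `k = 0` or `l = 0` the
corresponding sum is empty, in agreement with the zero values of `RawTot.horPart` and
`RawTot.vertPart`. -/
theorem RawFamily.val_fiberIntegral_d {p k l : ℕ} (h : k + l = p + 1) {φ : RawFamily M p}
    (hφ : φ ∈ realizationForms M p) (x : level M k)
    (w : Fin l → EuclideanSpace ℝ (Fin (level M k).dim)) :
    (fiberIntegral h (φ.d k)).val x w =
      RawForm.val (I := 𝓡 (level M k).dim) (φ.integral.horPart ⟨(k, l), h⟩) x w +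
        RawForm.val (I := 𝓡 (level M k).dim) (φ.integral.vertPart ⟨(k, l), h⟩) x w := by
  refine (_root_.val_fiberIntegral_d h (hφ.1 k).1 x w).trans (congrArg₂ (· + ·) ?_ ?_)
  · obtain _ | k := k
    · simp only [Finset.univ_eq_empty, Finset.sum_empty, integral_zero]
      rfl
    · have h' : k + l = p := by omega
      simp only [removeNth_blockVec_castAdd h h']
      exact integral_vertical_eq_horDiff h' hφ x w
  · obtain _ | l := l
    · simp only [Finset.univ_eq_empty, Finset.sum_empty, integral_zero, mul_zero]
      rfl
    · have h' : k + l = p := by omega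
      simp only [removeNth_blockVec_natAdd h h']
      rw [← val_d_fiberIntegral h' (hφ.1 k).1 x w]
      rfl

theorem RawFamily.D_integral {p : ℕ} {φ : RawFamily M p} (hφ : φ ∈ realizationForms M p) :
    φ.integral.D = φ.d.integral := by
  funext b x
  exact ContinuousAlternatingMap.ext fun w => (RawFamily.val_fiberIntegral_d b.2 hφ x w).symm

end

theorem mainTheorem5 (M : SimplicialObject SmoothMfd.{u}) :
    ∃ S : (p : ℕ) → realizationForms M p →ₗ[ℝ] Tot M p,
      (∀ (p : ℕ) (φ : realizationForms M p), (S p φ : RawTot M p) = (φ : RawFamily M p).integral) ∧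
      ∀ (p : ℕ) (φ : realizationForms M p),
        ∃ hd : (φ : RawFamily M p).d ∈ realizationForms M (p + 1),
          (S p φ : RawTot M p).D = (S (p + 1) ⟨(φ : RawFamily M p).d, hd⟩ : RawTot M (p + 1)) := by
  exact ⟨simplexIntegral M, fun _ _ => rfl, fun _ φ =>
    ⟨RawFamily.d_mem_realizationForms φ.2, RawFamily.D_integral φ.2⟩⟩
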